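/- Let $m\ge 2$ and let $E_1,\dots,E_m$ be metric spaces. Let $\big((X_n^1(\cdot),T_n^1),\dots,(X_n^m(\cdot),T_n^m)\big)$, $n\ge 1$, be independent and identically distributed random elements, with an arbitrary joint distribution of the $m$ entries for each $n$, where $X_n^i(\cdot)$ is an $E_i$-valued process indexed by $[0,\infty)$ with almost surely right-continuous paths, and where $T_n^i$ is almost surely nonnegative and has a nonarithmetic distribution (it is not concentrated on the integer multiples of any $d>0$) with positive finite mean $\mu_i$. Put $S_0^i=0$, $S_n^i=\sum_{k=1}^n T_k^i$, $N^i(t)=\sup\{n\ge 0: S_n^i\le t\}$ and $$X_i(t)=X^i_{N^i(t)+1}\big(t-S^i_{N^i(t)}\big),\qquad t\ge 0.$$ Suppose that $\mu_i\ne\mu_j$ for all $i\ne j$. Then for all $\beta_1,\dots,\beta_m\in\mathbb R$ the variables $X_1(t+\beta_1),\dots,X_m(t+\beta_m)$ are asymptotically independent as $t\to\infty$: with $\nu_i$ the probability measure on $E_i$ given by $$\int g\,d\nu_i=\frac1{\mu_i}\,E\int_0^{T_1^i} g\big(X_1^i(s)\big)\,ds\qquad\text{for all nonnegative Borel } g,$$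 the vector $\big(X_1(t+\beta_1),\dots,X_m(t+\beta_m)\big)$ converges in distribution to $\nu_1\otimes\cdots\otimes\nu_m$. That is, for all bounded continuous $f_i:E_i\to\mathbb R$, $$\lim_{t\to\infty}E\prod_{i=1}^m f_i\big(X_i(t+\beta_i)\big)=\prod_{i=1}^m\int f_i\,d\nu_i ,$$ and, if the spaces $E_i$ are separable, the law of the vector converges weakly on $E_1\times\cdots\times E_m$ to $\nu_1\otimes\cdots\otimes\nu_m$. -/

import Mathlib

open MeasureTheory ProbabilityTheory Filter Topology
open scoped NNReal ENNReal BoundedContinuousFunction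

noncomputable section

/-- A law on the real line is arithmetic if it is concentrated on the integer multiples of some
`d > 0`; otherwise it is nonarithmetic. -/
def IsNonarithmetic (ρ : Measure ℝ) : Prop :=
  ∀ d : ℝ, 0 < d → ¬ ∀ᵐ x ∂ρ, ∃ k : ℤ, x = k * d

section Regenerative

variable {Ω : Type*} {m : ℕ} {E : Fin m → Type*}

/- A sequence of cycles is a map `C : ℕ → Ω → ∀ i, (ℝ≥0 → E i) × ℝ`.  The cycle of component `i`
with number `n + 1` (numbers start at one) is the pair `C n ω i`: its first entry is the path of
the cycle, a function on `[0, ∞)`, and its second entry is the length of the cycle. -/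

/-- Mean length of a cycle of component `i` (the common mean of all of them). -/
def meanCycle [MeasurableSpace Ω] (P : Measure Ω) (C : ℕ → Ω → ∀ i, (ℝ≥0 → E i) × ℝ)
    (i : Fin m) : ℝ :=
  ∫ ω, (C 0 ω i).2 ∂P

/-- Regeneration epochs: the sum of the lengths of the first `n` cycles of component `i`. -/
def epoch (C : ℕ → Ω → ∀ i, (ℝ≥0 → E i) × ℝ) (i : Fin m) (n : ℕ) (ω : Ω) : ℝ :=
  ∑ k ∈ Finset.range n, (C k ω i).2

/-- The number `sup {n | S_n ≤ t}` of completed cycles of component `i` at time `t`.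
(For `t ≥ 0` the set contains zero, and it is almost surely bounded when the mean cycle length
is positive.) -/
def cycleCount (C : ℕ → Ω → ∀ i, (ℝ≥0 → E i) × ℝ) (i : Fin m) (t : ℝ) (ω : Ω) : ℕ :=
  sSup {n : ℕ | epoch C i n ω ≤ t}

/-- The regenerative process of component `i`: at time `t ≥ 0` it is the path of the cycle in
progress, which has number `cycleCount + 1`, at the time elapsed since that cycle began. -/
def regenerative (C : ℕ → Ω → ∀ i, (ℝ≥0 → E i) × ℝ) (i : Fin m) (t : ℝ) (ω : Ω) : E i :=
  (C (cycleCount C i t ω) ω i).1 (t - epoch C i (cycleCount C i t ω) ω).toNNReal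

/-- The standing assumptions on the cycles: random elements (for the product sigma-algebra on
paths) that are independent and identically distributed over the cycle number, with an arbitrary
joint law of the components within one cycle number; cycle lengths are almost surely nonnegative,
nonarithmetic, of positive finite mean; paths are almost surely right continuous. -/
structure IsCycleSequence [MeasurableSpace Ω] [∀ i, MetricSpace (E i)]
    [∀ i, MeasurableSpace (E i)] (P : Measure Ω)
    (C : ℕ → Ω → ∀ i, (ℝ≥0 → E i) × ℝ) : Prop where
  measurable : ∀ n, Measurable (C n)
  indep : iIndepFun C P
  identDistrib : ∀ n, IdentDistrib (C n) (C 0) P P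
  nonneg : ∀ i, ∀ᵐ ω ∂P, 0 ≤ (C 0 ω i).2
  nonarithmetic : ∀ i, IsNonarithmetic (P.map fun ω => (C 0 ω i).2)
  integrable : ∀ i, Integrable (fun ω => (C 0 ω i).2) P
  mean_pos : ∀ i, 0 < meanCycle P C i
  rightContinuous : ∀ n i, ∀ᵐ ω ∂P, ∀ s : ℝ≥0, ContinuousWithinAt (C n ω i).1 (Set.Ici s) s

/-- `ν` is the law with `∫ g dν = (E T)⁻¹ E ∫_0^T g(X(s)) ds` for all nonnegative Borel `g`,
where `(X, T)` is a cycle of component `i`. -/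
def IsCycleAverage [MeasurableSpace Ω] [∀ i, MeasurableSpace (E i)] (P : Measure Ω)
    (C : ℕ → Ω → ∀ i, (ℝ≥0 → E i) × ℝ) (i : Fin m) (ν : Measure (E i)) : Prop :=
  ∀ g : E i → ℝ≥0∞, Measurable g →
    ∫⁻ x, g x ∂ν = (ENNReal.ofReal (meanCycle P C i))⁻¹ *
      ∫⁻ ω, (∫⁻ s in Set.Ico (0 : ℝ) (C 0 ω i).2, g ((C 0 ω i).1 s.toNNReal)) ∂P

/-- `(Y 1 t, …, Y m t)` is asymptotically independent as `t → ∞`, with limiting marginals `ν i`: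
it converges in distribution to a vector of independent entries with laws `ν i`.  On arbitrary
metric spaces this is expressed by products of bounded continuous functions of the entries.  When
the spaces are separable, so that the Borel sets of the product space are the product sets, it is
moreover weak convergence of the law of the whole vector on the product space. -/
structure AsymptoticallyIndependent [MeasurableSpace Ω] [∀ i, MetricSpace (E i)]
    [∀ i, MeasurableSpace (E i)] [∀ i, BorelSpace (E i)] (P : Measure Ω) [IsProbabilityMeasure P]
    (Y : ∀ i, ℝ → Ω → E i) (ν : ∀ i, ProbabilityMeasure (E i)) : Prop where
  aemeasurable : ∀ i t, AEMeasurable (Y i t) P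
  tendsto_prod : ∀ f : ∀ i, E i →ᵇ ℝ,
    Tendsto (fun t : ℝ => ∫ ω, ∏ i, f i (Y i t ω) ∂P) atTop
      (𝓝 (∏ i, ∫ x, f i x ∂(ν i : Measure (E i))))
  tendstoInDistribution : ∀ [∀ i, SecondCountableTopology (E i)],
    TendstoInDistribution (fun (t : ℝ) ω i => Y i t ω) atTop (fun x : ∀ i, E i => x)
      (fun _ => P) (Measure.pi fun i => (ν i : Measure (E i)))

end Regenerative

end

set_option linter.unusedSectionVars false

/-! Different mean cycle lengths separate the components by cycle number. Let `a` be the component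
of smallest mean in a finite set, and choose `l` strictly between `μ_a` and the other means; this is
where distinctness of the means enters. Put `n = ⌊t / l⌋`. By the strong law, `S_n / t` tends to `μ
/ l` for every component. Almost surely, for large `t`, the slower components have therefore not
finished `n` cycles at time `t + β`, so their values are functions of the first `n` cycles.
Component `a` finished its `n`-th cycle long before, and `t + β_a - S_n → ∞`. Given the first `n`
cycles it is a fresh copy that has run for this long time, and the renewal theorem makes its
conditional mean converge to the integral against `ν_a`, whatever the dependence within a cycle
number. So `a` factors off, and induction on the set of components gives the product
(`condExp_regenerative`, `tendsto_integral_mul_regenerative_sub`, `tendsto_integral_prod`).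

The renewal theorem is proved from scratch. For compactly supported Lipschitz `z`, the increments of
`Z = z * U`, with `U` the renewal measure, are harmonic for the cycle-length law far to the right.
If their upper limit `a` were positive, values near `a` would propagate backwards along the additive
monoid generated by the support. That monoid is asymptotically dense because the law is
nonarithmetic, so arbitrarily many consecutive increments would be near `a`, against the boundedness
of `Z`. Hence the increments vanish, and the identity `∫ tail(x) Z(t - x) dx = ∫ z` identifies the
limit of `Z` (`upper_limit_nonpos_of_bounded_sum`, `tendsto_renewalConv`).

For a regenerative mean the function convolved with `U` is only right continuous. Lipschitz
approximation from below gives a lower bound on the lower limit. The same bound for `b - f` gives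
the upper one, since the means of `f` and `b - f` add up to `b` exactly (`tendsto_renewalMean`).

Finally, products of bounded continuous functions control rectangles with null frontiers, which
determine weak convergence when the spaces are separable (`tendsto_probabilityMeasure_pi`). -/

/-! ### The renewal measure -/

/-- The `n`-fold convolution power of a law on the real line. -/
noncomputable def convPow (ρ : Measure ℝ) : ℕ → Measure ℝ
  | 0 => Measure.dirac 0
  | n + 1 => convPow ρ n ∗ ρ

/-- The renewal measure of `ρ`, the sum of its convolution powers. -/
noncomputable def renewalMeasure (ρ : Measure ℝ) : Measure ℝ := Measure.sum (convPow ρ)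

/-- The tail `ρ (x, ∞)` on the positive half-line, extended by zero. -/
noncomputable def tail (ρ : Measure ℝ) (x : ℝ) : ℝ≥0∞ :=
  (Set.Ici (0 : ℝ)).indicator (fun x => ρ (Set.Ioi x)) x

section Renewal

theorem ae_nonneg_of_Iio {ρ : Measure ℝ} (h0 : ρ (Set.Iio 0) = 0) : ∀ᵐ x ∂ρ, 0 ≤ x := by
  rw [ae_iff]
  refine measure_mono_null (fun x hx => ?_) h0
  simpa using hx

theorem lintegral_renewalMeasure {ρ : Measure ℝ} (g : ℝ → ℝ≥0∞) :
    ∫⁻ x, g x ∂(renewalMeasure ρ) = ∑' n, ∫⁻ x, g x ∂(convPow ρ n) :=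
  lintegral_sum_measure _ _

theorem measurable_tail {ρ : Measure ℝ} : Measurable (tail ρ) := by
  refine Measurable.indicator ?_ measurableSet_Ici
  have : Antitone fun x : ℝ => ρ (Set.Ioi x) := fun x y h => measure_mono (Set.Ioi_subset_Ioi h)
  exact this.measurable

variable {ρ : Measure ℝ} [IsProbabilityMeasure ρ]

instance isProbabilityMeasure_convPow (n : ℕ) : IsProbabilityMeasure (convPow ρ n) := by
  induction n with
  | zero => unfold convPow; infer_instance
  | succ n ih => unfold convPow; infer_instance

instance sFinite_renewalMeasure : SFinite (renewalMeasure ρ) := by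
  unfold renewalMeasure; infer_instance

theorem lintegral_convPow_succ (n : ℕ) {g : ℝ → ℝ≥0∞} (hg : Measurable g) :
    ∫⁻ x, g x ∂(convPow ρ (n + 1)) = ∫⁻ x, ∫⁻ y, g (x + y) ∂ρ ∂(convPow ρ n) :=
  Measure.lintegral_conv hg

/-- The renewal equation. -/
theorem lintegral_renewalMeasure_eq {g : ℝ → ℝ≥0∞} (hg : Measurable g) :
    ∫⁻ x, g x ∂(renewalMeasure ρ) = g 0 + ∫⁻ x, ∫⁻ y, g (x + y) ∂ρ ∂(renewalMeasure ρ) := by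
  rw [lintegral_renewalMeasure, tsum_eq_zero_add' ENNReal.summable, lintegral_renewalMeasure]
  congr 1
  · simp [convPow, lintegral_dirac' _ hg]
  · exact tsum_congr fun n => lintegral_convPow_succ n hg

theorem tail_le_one (x : ℝ) : tail ρ x ≤ 1 := by
  unfold tail
  exact Set.indicator_apply_le' (fun _ => prob_le_one) (fun _ => zero_le)

/-- The event `S_n ≤ t` splits according to whether the next length exceeds `t - S_n`. Nonnegativity
of the lengths ensures that `S_{n+1} ≤ t` forces `S_n ≤ t`. -/
theorem lintegral_tail_convPow (h0 : ρ (Set.Iio 0) = 0) (n : ℕ) (t : ℝ) :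
    ∫⁻ s, tail ρ (t - s) ∂(convPow ρ n) + convPow ρ (n + 1) (Set.Iic t)
      = convPow ρ n (Set.Iic t) := by
  have hm : Measurable ((Set.Iic t).indicator (1 : ℝ → ℝ≥0∞)) :=
    measurable_one.indicator measurableSet_Iic
  rw [← lintegral_indicator_one measurableSet_Iic, lintegral_convPow_succ n hm,
    ← lintegral_indicator_one measurableSet_Iic,
    ← lintegral_add_left (f := fun s => tail ρ (t - s))
      (measurable_tail.comp (measurable_const.sub measurable_id))]
  refine lintegral_congr fun s => ?_
  have e : ∀ y, (Set.Iic t).indicator (1 : ℝ → ℝ≥0∞) (s + y)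
      = (Set.Iic (t - s)).indicator 1 y := fun y => by
    simp [Set.indicator, le_sub_iff_add_le, add_comm]
  simp_rw [e]
  rw [lintegral_indicator_one measurableSet_Iic]
  by_cases h : s ≤ t
  · have : tail ρ (t - s) = ρ (Set.Ioi (t - s)) := by simp [tail, h]
    simp only [this, Set.mem_Iic, h, Set.indicator_of_mem, Pi.one_apply]
    rw [← Set.compl_Iic, add_comm, prob_add_prob_compl measurableSet_Iic]
  · have : tail ρ (t - s) = 0 := by simp [tail, h]
    simp only [this, Set.mem_Iic, h, not_false_eq_true, Set.indicator_of_notMem, zero_add]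
    refine measure_mono_null (fun x hx => ?_) h0
    simp only [Set.mem_Iic, Set.mem_Iio] at *
    linarith

/-- Exponential Markov inequality: `P(S_n ≤ t) ≤ e^t c^n` with `c = E e^{-T} < 1`. -/
theorem tendsto_convPow_Iic (h0 : ρ (Set.Iio 0) = 0) (h1 : ρ (Set.Ioi 0) ≠ 0) (t : ℝ) :
    Tendsto (fun n => convPow ρ n (Set.Iic t)) atTop (𝓝 0) := by
  set e : ℝ → ℝ≥0∞ := fun x => ENNReal.ofReal (Real.exp (-x)) with he
  have hem : Measurable e := by fun_prop
  set c := ∫⁻ x, e x ∂ρ with hc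
  have hpow : ∀ n, ∫⁻ x, e x ∂(convPow ρ n) = c ^ n := fun n => by
    induction n with
    | zero => simp [convPow, he]
    | succ n ih =>
      have : ∀ x y, e (x + y) = e x * e y := fun x y => by
        simp only [he]
        rw [← ENNReal.ofReal_mul (Real.exp_nonneg _), ← Real.exp_add, neg_add]
      rw [lintegral_convPow_succ n hem]
      simp_rw [this, lintegral_const_mul _ hem]
      rw [lintegral_mul_const _ hem, ih, pow_succ]
  have hc1 : c < 1 := by
    have hae : ∀ᵐ x ∂ρ, e x ≤ 1 := by
      filter_upwards [ae_nonneg_of_Iio h0] with x hx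
      simp [he, hx]
    have : c < ∫⁻ _, 1 ∂ρ := by
      refine lintegral_strict_mono_of_ae_le_of_ae_lt_on (s := Set.Ioi 0) (by fun_prop) ?_ hae h1 ?_
      · exact ((lintegral_mono_ae hae).trans_lt (by simp)).ne
      · refine ae_of_all _ fun x hx => ?_
        simp only [he]
        rw [ENNReal.ofReal_lt_one]
        simpa using hx
    simpa using this
  have hb : ∀ n, convPow ρ n (Set.Iic t) ≤ ENNReal.ofReal (Real.exp t) * c ^ n := fun n => by
    rw [← hpow, ← lintegral_const_mul _ hem, ← lintegral_indicator_one measurableSet_Iic]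
    refine lintegral_mono fun x => Set.indicator_apply_le' (fun hx => ?_) (fun _ => zero_le)
    simp only [he]
    rw [← ENNReal.ofReal_mul (Real.exp_nonneg _), ← Real.exp_add, Pi.one_apply,
      ENNReal.one_le_ofReal]
    have : x ≤ t := hx
    exact Real.one_le_exp (by linarith)
  have hz := ENNReal.Tendsto.const_mul (ENNReal.tendsto_pow_atTop_nhds_zero_of_lt_one hc1)
    (a := ENNReal.ofReal (Real.exp t)) (Or.inr ENNReal.ofReal_ne_top)
  rw [mul_zero] at hz
  exact tendsto_of_tendsto_of_tendsto_of_le_of_le tendsto_const_nhds hz (fun _ => zero_le) hb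

/-- The probability that some cycle is in progress at time `t ≥ 0` is one. -/
theorem lintegral_tail_renewalMeasure (h0 : ρ (Set.Iio 0) = 0) (h1 : ρ (Set.Ioi 0) ≠ 0) (t : ℝ) :
    ∫⁻ s, tail ρ (t - s) ∂(renewalMeasure ρ) = (Set.Ici (0 : ℝ)).indicator 1 t := by
  rw [lintegral_renewalMeasure]
  -- The sum telescopes, leaving the remainder `P(S_N ≤ t)`, which tends to zero.
  have hsum : ∀ N, ∑ n ∈ Finset.range N, ∫⁻ s, tail ρ (t - s) ∂(convPow ρ n)
      + convPow ρ N (Set.Iic t) = (Set.Ici (0 : ℝ)).indicator 1 t := fun N => by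
    induction N with
    | zero => simp [convPow, Set.indicator, Measure.dirac_apply' _ measurableSet_Iic]
    | succ N ih => rw [Finset.sum_range_succ, add_assoc, lintegral_tail_convPow h0, ih]
  have hz := (ENNReal.summable (f := fun n => ∫⁻ s, tail ρ (t - s) ∂(convPow ρ n))
    ).hasSum.tendsto_sum_nat.add (tendsto_convPow_Iic h0 h1 t)
  simp_rw [hsum, add_zero] at hz
  exact tendsto_nhds_unique hz tendsto_const_nhds |>.symm ▸ rfl

/-- If `ρ (δ, ∞) > 0`, an epoch in `[a, a + δ]` is followed with at least that probability by a
cycle in progress at `a + δ`. These events for different cycles have total probability at most one,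
which bounds the mass of `[a, a + δ]` uniformly in `a`; longer intervals are covered by such pieces.
-/
theorem exists_renewalMeasure_Icc_le (h0 : ρ (Set.Iio 0) = 0) (h1 : ρ (Set.Ioi 0) ≠ 0) (l : ℝ) :
    ∃ B : ℝ≥0, ∀ a, renewalMeasure ρ (Set.Icc a (a + l)) ≤ B := by
  obtain ⟨δ, hδ, hpos⟩ : ∃ δ : ℝ, 0 < δ ∧ ρ (Set.Ioi δ) ≠ 0 := by
    by_contra! h
    refine h1 (measure_mono_null (t := ⋃ n : ℕ, Set.Ioi (1 / ((n : ℝ) + 1))) (fun x hx => ?_)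
      (measure_iUnion_null fun n => h _ (by positivity)))
    obtain ⟨n, hn⟩ := exists_nat_one_div_lt (show (0 : ℝ) < x from hx)
    exact Set.mem_iUnion.2 ⟨n, hn⟩
  have hshort : ∀ a, renewalMeasure ρ (Set.Icc a (a + δ)) ≤ (ρ (Set.Ioi δ))⁻¹ := fun a => by
    rw [← one_div, ENNReal.le_div_iff_mul_le (Or.inl hpos) (Or.inl (measure_ne_top _ _)), mul_comm]
    calc ρ (Set.Ioi δ) * renewalMeasure ρ (Set.Icc a (a + δ))
        = ∫⁻ s, (Set.Icc a (a + δ)).indicator (fun _ => ρ (Set.Ioi δ)) s ∂(renewalMeasure ρ) := by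
          rw [lintegral_indicator_const measurableSet_Icc]
      _ ≤ ∫⁻ s, tail ρ (a + δ - s) ∂(renewalMeasure ρ) := by
          refine lintegral_mono fun s => Set.indicator_apply_le' (fun hs => ?_) (fun _ => zero_le)
          have hs' : 0 ≤ a + δ - s := by linarith [hs.2]
          rw [tail, Set.indicator_of_mem (Set.mem_Ici.2 hs')]
          exact measure_mono (Set.Ioi_subset_Ioi (by linarith [hs.1]))
      _ ≤ 1 := by
          rw [lintegral_tail_renewalMeasure h0 h1]
          exact Set.indicator_apply_le' (fun _ => le_rfl) (fun _ => zero_le)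
  obtain ⟨N, hN⟩ := exists_nat_gt (l / δ)
  rw [div_lt_iff₀ hδ] at hN
  refine ⟨(∑ _k ∈ Finset.range N, (ρ (Set.Ioi δ))⁻¹).toNNReal, fun a => ?_⟩
  rw [ENNReal.coe_toNNReal]
  swap
  · exact (ENNReal.sum_lt_top.2 fun _ _ => ENNReal.inv_lt_top.2 (pos_iff_ne_zero.2 hpos)).ne
  calc renewalMeasure ρ (Set.Icc a (a + l))
      ≤ renewalMeasure ρ (⋃ k ∈ Finset.range N, Set.Icc (a + k * δ) (a + k * δ + δ)) := by
        refine measure_mono fun x hx => ?_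
        simp only [Set.mem_iUnion, Finset.mem_range]
        have hx0 : 0 ≤ (x - a) / δ := div_nonneg (by linarith [hx.1]) hδ.le
        have hf1 := Nat.floor_le hx0
        have hf2 := Nat.lt_floor_add_one ((x - a) / δ)
        rw [le_div_iff₀ hδ] at hf1
        rw [div_lt_iff₀ hδ] at hf2
        refine ⟨⌊(x - a) / δ⌋₊, ?_, by linarith, by linarith⟩
        have : ((⌊(x - a) / δ⌋₊ : ℕ) : ℝ) * δ < N * δ := by linarith [hx.2]
        exact_mod_cast lt_of_mul_lt_mul_right this hδ.le
    _ ≤ ∑ k ∈ Finset.range N, renewalMeasure ρ (Set.Icc (a + k * δ) (a + k * δ + δ)) :=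
        measure_biUnion_finset_le _ _
    _ ≤ _ := Finset.sum_le_sum fun k _ => hshort _

end Renewal

/-! ### Asymptotic density of nonlattice additive monoids -/

theorem AddSubgroup.exists_sub_of_mem_closure {A : Type*} [AddCommGroup A] {S : Set A} {g : A}
    (hg : g ∈ AddSubgroup.closure S) :
    ∃ p ∈ AddSubmonoid.closure S, ∃ q ∈ AddSubmonoid.closure S, g = q - p := by
  induction hg using AddSubgroup.closure_induction with
  | mem x hx => exact ⟨0, zero_mem _, x, AddSubmonoid.subset_closure hx, by simp⟩
  | zero => exact ⟨0, zero_mem _, 0, zero_mem _, by simp⟩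
  | add x y _ _ hx hy =>
    obtain ⟨p, hp, q, hq, rfl⟩ := hx
    obtain ⟨p', hp', q', hq', rfl⟩ := hy
    exact ⟨p + p', add_mem hp hp', q + q', add_mem hq hq', by abel⟩
  | neg x _ hx =>
    obtain ⟨p, hp, q, hq, rfl⟩ := hx
    exact ⟨q, hq, p, hp, by abel⟩

/-- A set of nonnegative reals that is not contained in a lattice generates an additive monoid
which is asymptotically dense. -/
theorem exists_mem_addSubmonoid_closure_near {S : Set ℝ} (h0 : ∀ x ∈ S, 0 ≤ x)
    (hS : ∀ d : ℝ, 0 < d → ∃ x ∈ S, ∀ k : ℤ, x ≠ k * d) {ε : ℝ} (hε : 0 < ε) :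
    ∃ y₀ : ℝ, ∀ y, y₀ ≤ y → ∃ s ∈ AddSubmonoid.closure S, |s - y| < ε := by
  have hdense : Dense (AddSubgroup.closure S : Set ℝ) := by
    refine (AddSubgroup.dense_or_cyclic _).resolve_right ?_
    rintro ⟨a, ha⟩
    have hmul : ∀ x ∈ S, ∃ k : ℤ, k • a = x := fun x hx =>
      AddSubgroup.mem_closure_singleton.1 (ha ▸ AddSubgroup.subset_closure hx)
    rcases eq_or_ne a 0 with rfl | hne
    · obtain ⟨x, hx, hk⟩ := hS 1 one_pos
      obtain ⟨k, rfl⟩ := hmul x hx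
      exact hk 0 (by simp)
    · obtain ⟨x, hx, hk⟩ := hS |a| (abs_pos.2 hne)
      obtain ⟨k, rfl⟩ := hmul x hx
      rcases abs_choice a with h | h
      · exact hk k (by rw [h]; simp)
      · exact hk (-k) (by rw [h]; simp)
  -- A group element `g` in `(0, ε)`, written `q - p` with `p`, `q` in the monoid: replacing one
  -- summand `p` by `q` moves a sum by the small step `g`.
  obtain ⟨g, hg, hgS⟩ := hdense.exists_mem_open isOpen_Ioo (Set.nonempty_Ioo.2 hε)
  obtain ⟨p', hp', q', hq', hgpq⟩ := AddSubgroup.exists_sub_of_mem_closure hg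
  obtain ⟨s, hs, hk⟩ := hS 1 one_pos
  have hs0 : 0 < s := lt_of_le_of_ne (h0 s hs) fun h => hk 0 (by simp [← h])
  have hnonneg : ∀ x ∈ AddSubmonoid.closure S, 0 ≤ x := fun x hx => by
    induction hx using AddSubmonoid.closure_induction with
    | mem x hx => exact h0 x hx
    | zero => exact le_rfl
    | add x y _ _ hx hy => exact add_nonneg hx hy
  -- Adding the same positive `s` to both keeps the difference and makes `p` positive.
  set p := p' + s with hp
  set q := q' + s with hq
  have hpM : p ∈ AddSubmonoid.closure S := add_mem hp' (AddSubmonoid.subset_closure hs)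
  have hqM : q ∈ AddSubmonoid.closure S := add_mem hq' (AddSubmonoid.subset_closure hs)
  have hp0 : 0 < p := by linarith [hnonneg p' hp']
  have hqp : g = q - p := by rw [hgpq]; ring
  -- For `k ≥ k₀` the points `(k - j) p + j q = k p + j g`, `0 ≤ j ≤ k`, run through `[k p, (k + 1)
  -- p]` in steps of `g < ε`.
  obtain ⟨k₀, hk₀⟩ := exists_nat_gt (p / g)
  rw [div_lt_iff₀ hgS.1] at hk₀
  refine ⟨k₀ * p, fun y hy => ?_⟩
  have hy0 : 0 ≤ y / p := div_nonneg (le_trans (by positivity) hy) hp0.le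
  set k := ⌊y / p⌋₊ with hkdef
  have hk1 : k * p ≤ y := by rw [← le_div_iff₀ hp0]; exact Nat.floor_le hy0
  have hk2 : y < (k + 1) * p := by rw [← div_lt_iff₀ hp0]; exact Nat.lt_floor_add_one _
  have hkk : k₀ ≤ k := Nat.le_floor (by rwa [le_div_iff₀ hp0])
  have hj0 : 0 ≤ (y - k * p) / g := div_nonneg (by linarith) hgS.1.le
  set j := ⌊(y - k * p) / g⌋₊ with hjdef
  have hj1 : j * g ≤ y - k * p := by rw [← le_div_iff₀ hgS.1]; exact Nat.floor_le hj0
  have hj2 : y - k * p < (j + 1) * g := by rw [← div_lt_iff₀ hgS.1]; exact Nat.lt_floor_add_one _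
  have hjk : j ≤ k := by
    refine le_trans ?_ hkk
    have : (j : ℝ) * g < k₀ * g := by linarith
    exact_mod_cast (lt_of_mul_lt_mul_right this hgS.1.le).le
  refine ⟨(k - j) • p + j • q, add_mem (nsmul_mem hpM _) (nsmul_mem hqM _), ?_⟩
  have : (((k - j : ℕ) • p + j • q : ℝ)) = k * p + j * g := by
    rw [nsmul_eq_mul, nsmul_eq_mul, Nat.cast_sub hjk, hqp]; ring
  rw [this, abs_lt]
  constructor <;> linarith [hgS.2]

/-! ### Asymptotically harmonic functions -/

section Harmonic

variable {ρ : Measure ℝ} [IsProbabilityMeasure ρ] {u : ℝ → ℝ} {a B L : ℝ}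

/-- Where an asymptotically harmonic function comes close to its upper limit, it does so on the
translates by points in the support of the law as well. -/
theorem tendsto_sub_of_mem_support (hum : Measurable u) (hub : ∀ t, |u t| ≤ B)
    (huL : ∀ s t, |s - t| ≤ 1 → |u s - u t| ≤ L * |s - t|)
    (hu : ∀ᶠ t in atTop, u t = ∫ y, u (t - y) ∂ρ) (ha : ∀ η > 0, ∀ᶠ t in atTop, u t ≤ a + η)
    {y₀ : ℝ} (hy₀ : y₀ ∈ ρ.support) {t : ℕ → ℝ} (ht : Tendsto t atTop atTop)
    (hta : Tendsto (fun n => u (t n)) atTop (𝓝 a)) :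
    Tendsto (fun n => u (t n - y₀)) atTop (𝓝 a) := by
  have hshift : ∀ y, Tendsto (fun n => t n - y) atTop atTop := fun y =>
    tendsto_atTop_add_const_right _ (-y) ht
  have hint : ∀ n, Integrable (fun y => u (t n - y)) ρ := fun n =>
    Integrable.of_bound (hum.comp (measurable_const.sub measurable_id)).aestronglyMeasurable B (ae_of_all _ fun y => by simpa using hub _)
  -- The excess over `a` vanishes in mean, because `a` is an asymptotic upper bound. By harmonicity
  -- the mean of `a - u (t n - y)` is `a - u (t n)`, which tends to zero, so the deficit below `a`
  -- vanishes in mean too.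
  have hp : Tendsto (fun n => ∫ y, max (u (t n - y) - a) 0 ∂ρ) atTop (𝓝 0) := by
    suffices h : Tendsto (fun n => ∫ y, max (u (t n - y) - a) 0 ∂ρ) atTop (𝓝 (∫ _, 0 ∂ρ)) by
      simpa using h
    refine tendsto_integral_of_dominated_convergence (fun _ => B + |a|)
      (fun n => ((hint n).sub (integrable_const a)).pos_part.aestronglyMeasurable) (integrable_const _) (fun n => ae_of_all _ fun y => ?_)
      (ae_of_all _ fun y => ?_)
    · rw [Real.norm_eq_abs, abs_of_nonneg (le_max_right _ _)]
      have h1 := hub (t n - y)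
      have h2 := neg_abs_le a
      rw [abs_le] at h1
      exact max_le (by linarith) (by linarith [abs_nonneg a])
    · rw [Metric.tendsto_atTop']
      intro η hη
      obtain ⟨N, hN⟩ := eventually_atTop.1 ((hshift y).eventually (ha (η / 2) (half_pos hη)))
      refine ⟨N, fun n hn => ?_⟩
      rw [Real.dist_eq, sub_zero, abs_of_nonneg (le_max_right _ _)]
      exact max_lt (by linarith [hN n hn.le]) hη
  have hv : Tendsto (fun n => ∫ y, max (a - u (t n - y)) 0 ∂ρ) atTop (𝓝 0) := by
    have h0 : Tendsto (fun n => a - u (t n) + ∫ y, max (u (t n - y) - a) 0 ∂ρ) atTop (𝓝 0) := by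
      simpa using ((tendsto_const_nhds (x := a)).sub hta).add hp
    refine h0.congr' ?_
    filter_upwards [ht.eventually hu] with n hn
    have hi : Integrable (fun y => max (u (t n - y) - a) 0) ρ :=
      ((hint n).sub (integrable_const a)).pos_part
    have e : a - u (t n) = ∫ y, (a - u (t n - y)) ∂ρ := by
      rw [integral_sub (integrable_const a) (hint n), ← hn]; simp
    rw [e, ← integral_add (f := fun y => a - u (t n - y)) ((integrable_const a).sub (hint n)) hi]
    refine integral_congr_ae (ae_of_all _ fun y => ?_)
    simp only [max_def]
    split_ifs <;> linarith
  rw [Metric.tendsto_atTop']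
  intro η hη
  -- On the ball of radius `r` about `y₀` the function `u (t n - ·)` moves by at most `η / 2`. A
  -- deficit of `η` at `y₀` would thus cost at least `η / 2` times the mass of the ball, positive
  -- since `y₀` is in the support. The `1` in the minimum keeps within the range of `huL`, and `|L|
  -- + 1` avoids any assumption on the sign of `L`.
  set r : ℝ := min 1 (η / (2 * (|L| + 1))) with hr
  have hr0 : 0 < r := lt_min one_pos (by positivity)
  have hrL : L * r ≤ η / 2 := by
    have h1 : r ≤ η / (2 * (|L| + 1)) := min_le_right _ _
    rw [le_div_iff₀ (by positivity)] at h1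
    nlinarith [le_abs_self L]
  have hpos : 0 < ρ.real (Metric.ball y₀ r) :=
    ENNReal.toReal_pos ((Measure.mem_support_iff_forall y₀).1 hy₀ _
      (Metric.ball_mem_nhds y₀ hr0)).ne' (measure_ne_top _ _)
  have h1 := (hshift y₀).eventually (ha (η / 2) (half_pos hη))
  have h2 := hv.eventually (gt_mem_nhds (mul_pos (half_pos hη) hpos))
  obtain ⟨N, hN⟩ := eventually_atTop.1 (h1.and h2)
  refine ⟨N, fun n hn => ?_⟩
  obtain ⟨h1, h2⟩ := hN n hn.le
  rw [Real.dist_eq, abs_lt]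
  refine ⟨?_, by linarith⟩
  by_contra! hcon
  refine absurd h2 (not_lt.2 ?_)
  calc η / 2 * ρ.real (Metric.ball y₀ r)
      = ∫ y, (Metric.ball y₀ r).indicator (fun _ => η / 2) y ∂ρ := by
        rw [integral_indicator_const _ Metric.isOpen_ball.measurableSet, smul_eq_mul, mul_comm]
    _ ≤ ∫ y, max (a - u (t n - y)) 0 ∂ρ := by
        refine integral_mono ((integrable_const _).indicator Metric.isOpen_ball.measurableSet)
          ((integrable_const a).sub (hint n)).pos_part fun y => ?_
        refine Set.indicator_apply_le' (fun hy => ?_) (fun _ => le_max_right _ _)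
        refine le_max_of_le_left ?_
        rw [Metric.mem_ball, Real.dist_eq] at hy
        have e : |(t n - y) - (t n - y₀)| = |y - y₀| := by rw [← abs_neg]; congr 1; ring
        have h3 := huL (t n - y) (t n - y₀) (by rw [e]; exact hy.le.trans (min_le_left _ _))
        rw [e] at h3
        have h4 := (abs_le.1 h3).2
        have h5 : L * |y - y₀| ≤ η / 2 := by
          rcases le_total 0 L with hL | hL
          · exact (mul_le_mul_of_nonneg_left hy.le hL).trans hrL
          · exact (mul_nonpos_of_nonpos_of_nonneg hL (abs_nonneg _)).trans (half_pos hη).le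
        linarith

/-- The sequence is quantified after the monoid element because for a sum `x + y` the claim for `y`
is applied to the sequence already shifted by `x`. -/
theorem tendsto_sub_of_mem_closure_support (hum : Measurable u) (hub : ∀ t, |u t| ≤ B)
    (huL : ∀ s t, |s - t| ≤ 1 → |u s - u t| ≤ L * |s - t|)
    (hu : ∀ᶠ t in atTop, u t = ∫ y, u (t - y) ∂ρ) (ha : ∀ η > 0, ∀ᶠ t in atTop, u t ≤ a + η)
    {y : ℝ} (hy : y ∈ AddSubmonoid.closure ρ.support) : ∀ {t : ℕ → ℝ}, Tendsto t atTop atTop →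
    Tendsto (fun n => u (t n)) atTop (𝓝 a) → Tendsto (fun n => u (t n - y)) atTop (𝓝 a) := by
  induction hy using AddSubmonoid.closure_induction with
  | mem y hy => exact fun ht hta => tendsto_sub_of_mem_support hum hub huL hu ha hy ht hta
  | zero => simp
  | add x y _ _ hx hy =>
    intro t ht hta
    have := hy (tendsto_atTop_add_const_right _ (-x) ht) (hx ht hta)
    simpa [sub_sub, ← sub_eq_add_neg] using this

/-- Discrete derivatives of a bounded function that are asymptotically harmonic for a nonarithmetic
law have a nonpositive upper limit. -/
theorem upper_limit_nonpos_of_bounded_sum {Z : ℝ → ℝ} {δ B' : ℝ} (hδ : 0 < δ)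
    (hZ : ∀ t, |Z t| ≤ B') (huZ : ∀ t, u t = Z (t + δ) - Z t)
    (h0 : ρ (Set.Iio 0) = 0) (hρ : IsNonarithmetic ρ)
    (hum : Measurable u) (hub : ∀ t, |u t| ≤ B)
    (huL : ∀ s t, |s - t| ≤ 1 → |u s - u t| ≤ L * |s - t|)
    (hu : ∀ᶠ t in atTop, u t = ∫ y, u (t - y) ∂ρ) (ha : ∀ η > 0, ∀ᶠ t in atTop, u t ≤ a + η)
    {t : ℕ → ℝ} (ht : Tendsto t atTop atTop)
    (hta : Tendsto (fun n => u (t n)) atTop (𝓝 a)) : a ≤ 0 := by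
  by_contra! hapos
  set ε : ℝ := min 1 (a / (4 * (|L| + 1))) with hε
  have hε0 : 0 < ε := lt_min one_pos (by positivity)
  have hεL : |L| * ε ≤ a / 4 := by
    have h1 : ε ≤ a / (4 * (|L| + 1)) := min_le_right _ _
    rw [le_div_iff₀ (by positivity)] at h1
    nlinarith
  have hsupp0 : ∀ x ∈ ρ.support, 0 ≤ x := fun x hx =>
    Measure.support_subset_of_isClosed isClosed_Ici (ae_nonneg_of_Iio h0) hx
  have hsupp : ∀ d : ℝ, 0 < d → ∃ x ∈ ρ.support, ∀ k : ℤ, x ≠ k * d := fun d hd => by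
    by_contra! h
    exact hρ d hd (by filter_upwards [Measure.support_mem_ae] with x hx using h x hx)
  obtain ⟨y₀, hy₀⟩ := exists_mem_addSubmonoid_closure_near hsupp0 hsupp hε0
  -- This many consecutive increments of size `a / 2` exceed the total variation `2 B'` available
  -- between two values of `Z`.
  obtain ⟨k, hk⟩ := exists_nat_gt (2 * B' / (a / 2))
  rw [div_lt_iff₀ (by positivity)] at hk
  have hev : ∀ j ∈ Finset.range k, ∀ᶠ n in atTop, a / 2 ≤ u (t n - y₀ - (j + 1) * δ) := by
    intro j _
    -- Moving back past `y₀` reaches the region where the monoid is `ε`-dense. At `t n - s` the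
    -- value of `u` eventually exceeds `3a / 4`, and the Lipschitz bound loses at most `a / 4` in
    -- passing to the grid point.
    obtain ⟨s, hs, hsy⟩ := hy₀ (y₀ + (j + 1) * δ) (by
      have : (0 : ℝ) ≤ (j + 1) * δ := by positivity
      linarith)
    have h1 := tendsto_sub_of_mem_closure_support hum hub huL hu ha hs ht hta
    filter_upwards [h1.eventually (lt_mem_nhds (show a * (3 / 4) < a by linarith))] with n hn
    have e : |(t n - y₀ - (j + 1) * δ) - (t n - s)| = |s - (y₀ + (j + 1) * δ)| := by
      congr 1; ring
    have h2 := huL (t n - y₀ - (j + 1) * δ) (t n - s)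
      (by rw [e]; exact hsy.le.trans (min_le_left _ _))
    rw [e] at h2
    have h3 : L * |s - (y₀ + (j + 1) * δ)| ≤ a / 4 :=
      (mul_le_mul (le_abs_self L) hsy.le (abs_nonneg _) (abs_nonneg _)).trans hεL
    linarith [(abs_le.1 h2).1]
  obtain ⟨n, hn⟩ := ((Finset.eventually_all _).2 hev).exists
  have htel : ∀ N : ℕ, ∑ j ∈ Finset.range N, u (t n - y₀ - (j + 1) * δ)
      = Z (t n - y₀) - Z (t n - y₀ - N * δ) := fun N => by
    induction N with
    | zero => simp
    | succ N ih =>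
      rw [Finset.sum_range_succ, ih, huZ]
      have : t n - y₀ - (N + 1) * δ + δ = t n - y₀ - N * δ := by ring
      rw [this]; push_cast; ring
  have h1 : (k : ℝ) * (a / 2) ≤ ∑ j ∈ Finset.range k, u (t n - y₀ - (j + 1) * δ) := by
    have := Finset.card_nsmul_le_sum (Finset.range k) (fun j => u (t n - y₀ - (j + 1) * δ))
      (a / 2) hn
    simpa using this
  rw [htel] at h1
  have h2 := abs_le.1 (hZ (t n - y₀))
  have h3 := abs_le.1 (hZ (t n - y₀ - k * δ))
  linarith

end Harmonic

/-! ### Blackwell's renewal theorem -/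

/-- The convolution of a function with the renewal measure. -/
noncomputable def renewalConv (ρ : Measure ℝ) (z : ℝ → ℝ) (t : ℝ) : ℝ :=
  ∫ s, z (t - s) ∂(renewalMeasure ρ)

section Blackwell

variable {ρ : Measure ℝ} [IsProbabilityMeasure ρ]

theorem renewalMeasure_eq : renewalMeasure ρ = Measure.dirac 0 + ρ ∗ renewalMeasure ρ := by
  refine Measure.ext_of_lintegral _ fun g hg => ?_
  rw [lintegral_add_measure, lintegral_renewalMeasure_eq hg, lintegral_dirac' _ hg,
    Measure.conv_comm, Measure.lintegral_conv hg]

/-- One constant `B` serves all locations `a` and all `g`. With `c` a supremum of `|z|` this bounds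
`renewalConv`, and with `c = K |t - t'|` it gives the Lipschitz estimate. -/
theorem exists_integral_renewalMeasure_le (h0 : ρ (Set.Iio 0) = 0) (h1 : ρ (Set.Ioi 0) ≠ 0)
    (l : ℝ) : ∃ B : ℝ, 0 ≤ B ∧ ∀ (g : ℝ → ℝ) (a c : ℝ), 0 ≤ c → Measurable g → (∀ s, |g s| ≤ c) →
      (∀ s, s ∉ Set.Icc a (a + l) → g s = 0) →
      Integrable g (renewalMeasure ρ) ∧ |∫ s, g s ∂(renewalMeasure ρ)| ≤ B * c := by
  obtain ⟨B, hB⟩ := exists_renewalMeasure_Icc_le h0 h1 l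
  refine ⟨B, B.2, fun g a c hc hg hgc hg0 => ?_⟩
  have hfin : renewalMeasure ρ (Set.Icc a (a + l)) ≠ ∞ :=
    ((hB a).trans_lt ENNReal.coe_lt_top).ne
  have hi : Integrable ((Set.Icc a (a + l)).indicator fun _ => c) (renewalMeasure ρ) :=
    (integrable_indicator_iff measurableSet_Icc).2 (integrableOn_const hfin)
  have hle : ∀ s, |g s| ≤ (Set.Icc a (a + l)).indicator (fun _ => c) s := fun s => by
    by_cases hs : s ∈ Set.Icc a (a + l)
    · rw [Set.indicator_of_mem hs]; exact hgc s
    · rw [Set.indicator_of_notMem hs, hg0 s hs, abs_zero]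
  refine ⟨hi.mono' hg.aestronglyMeasurable (ae_of_all _ hle), ?_⟩
  refine (norm_integral_le_of_norm_le (f := g) hi (ae_of_all _ hle)).trans ?_
  rw [integral_indicator_const _ measurableSet_Icc, smul_eq_mul]
  refine mul_le_mul_of_nonneg_right ?_ hc
  exact ENNReal.toReal_le_of_le_ofReal B.2 (by simpa using hB a)

theorem HasCompactSupport.exists_eq_zero_of_lt_abs {z : ℝ → ℝ} (hz : HasCompactSupport z) :
    ∃ R : ℝ, 0 ≤ R ∧ ∀ x, R < |x| → z x = 0 := by
  obtain ⟨R, hR⟩ := hz.isCompact.isBounded.subset_closedBall 0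
  refine ⟨max R 0, le_max_right _ _, fun x hx => ?_⟩
  by_contra hne
  have := hR (subset_tsupport z hne)
  rw [mem_closedBall_zero_iff, Real.norm_eq_abs] at this
  exact absurd (this.trans (le_max_left _ _)) (not_le.2 hx)

variable {z : ℝ → ℝ} {K : ℝ≥0}

theorem integrable_and_bounded_renewalConv (h0 : ρ (Set.Iio 0) = 0) (h1 : ρ (Set.Ioi 0) ≠ 0)
    (hz : Continuous z) (hzc : HasCompactSupport z) :
    (∀ t, Integrable (fun s => z (t - s)) (renewalMeasure ρ)) ∧
      ∃ B, ∀ t, |renewalConv ρ z t| ≤ B := by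
  obtain ⟨R, hR0, hR⟩ := hzc.exists_eq_zero_of_lt_abs
  obtain ⟨c, hc⟩ := hzc.exists_bound_of_continuous hz
  obtain ⟨B, hB0, hB⟩ := exists_integral_renewalMeasure_le h0 h1 (2 * R)
  have h : ∀ t, Integrable (fun s => z (t - s)) (renewalMeasure ρ) ∧
      |∫ s, z (t - s) ∂(renewalMeasure ρ)| ≤ B * c := fun t =>
    hB _ (t - R) c ((norm_nonneg _).trans (hc 0)) (by fun_prop) (fun s => hc _) fun s hs => by
      refine hR _ ?_
      by_contra! hle
      rw [abs_le] at hle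
      exact hs ⟨by linarith, by linarith⟩
  exact ⟨fun t => (h t).1, B * c, fun t => (h t).2⟩

theorem exists_lipschitz_renewalConv (h0 : ρ (Set.Iio 0) = 0) (h1 : ρ (Set.Ioi 0) ≠ 0)
    (hz : LipschitzWith K z) (hzc : HasCompactSupport z) :
    ∃ L, ∀ s t, |s - t| ≤ 1 → |renewalConv ρ z s - renewalConv ρ z t| ≤ L * |s - t| := by
  obtain ⟨R, hR0, hR⟩ := hzc.exists_eq_zero_of_lt_abs
  -- For `|t - t'| ≤ 1` both translates of `z` vanish outside `[t - R - 1, t + R + 1]`, which is why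
  -- the estimate is restricted to nearby points.
  obtain ⟨B, hB0, hB⟩ := exists_integral_renewalMeasure_le h0 h1 (2 * R + 2)
  have hi := (integrable_and_bounded_renewalConv h0 h1 hz.continuous hzc).1
  have hc := hz.continuous
  refine ⟨B * K, fun t t' ht => ?_⟩
  rw [renewalConv, renewalConv, ← integral_sub (hi t) (hi t'), mul_assoc]
  refine (hB _ (t - R - 1) (K * |t - t'|) (by positivity) (by fun_prop) (fun s => ?_)
    fun s hs => ?_).2
  · have := hz.dist_le_mul (t - s) (t' - s)
    simpa [Real.dist_eq] using this
  · rw [abs_le] at ht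
    rw [hR, hR, sub_zero]
    all_goals
      by_contra! hle
      rw [abs_le] at hle
      exact hs ⟨by linarith, by linarith⟩

theorem measurable_renewalConv (hz : Continuous z) : Measurable (renewalConv ρ z) := by
  have : StronglyMeasurable fun p : ℝ × ℝ => z (p.1 - p.2) :=
    (by fun_prop : Continuous fun p : ℝ × ℝ => z (p.1 - p.2)).stronglyMeasurable
  exact this.integral_prod_right'.measurable

theorem renewalConv_eq (h0 : ρ (Set.Iio 0) = 0) (h1 : ρ (Set.Ioi 0) ≠ 0)
    (hz : Continuous z) (hzc : HasCompactSupport z) (t : ℝ) :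
    renewalConv ρ z t = z t + ∫ y, renewalConv ρ z (t - y) ∂ρ := by
  have hi := (integrable_and_bounded_renewalConv h0 h1 hz hzc).1 t
  rw [renewalMeasure_eq, integrable_add_measure] at hi
  rw [renewalConv, renewalMeasure_eq, integral_add_measure hi.1 hi.2, integral_dirac, sub_zero,
    integral_conv hi.2]
  simp only [renewalConv, sub_sub]

/-- The increment of `z * U` is `w * U` with `w = z (· + δ) - z`, so by the renewal equation it is
harmonic to the right of the support of `w`. Its upper limit is attained along a sequence and is
nonpositive by `upper_limit_nonpos_of_bounded_sum`. No sign of `z` is assumed, so that `-z` yields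
the opposite bound. -/
theorem eventually_renewalConv_sub_le (h0 : ρ (Set.Iio 0) = 0) (h1 : ρ (Set.Ioi 0) ≠ 0)
    (hρ : IsNonarithmetic ρ) (hz : LipschitzWith K z) (hzc : HasCompactSupport z) {δ : ℝ}
    (hδ : 0 < δ) {η : ℝ} (hη : 0 < η) :
    ∀ᶠ t in atTop, renewalConv ρ z (t + δ) - renewalConv ρ z t ≤ η := by
  set w : ℝ → ℝ := fun x => z (x + δ) - z x with hw
  have hzδ : LipschitzWith (K * 1) fun x => z (x + δ) :=
    hz.comp (LipschitzWith.of_dist_le_mul fun x y => by simp)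
  have hwL : LipschitzWith (K * 1 + K) w := hzδ.sub hz
  have hzδc : HasCompactSupport fun x => z (x + δ) := hzc.comp_homeomorph (Homeomorph.addRight δ)
  have hwc : HasCompactSupport w := hzδc.sub hzc
  obtain ⟨hzi, B', hB'⟩ := integrable_and_bounded_renewalConv h0 h1 hz.continuous hzc
  obtain ⟨-, B, hB⟩ := integrable_and_bounded_renewalConv h0 h1 hwL.continuous hwc
  obtain ⟨L, hL⟩ := exists_lipschitz_renewalConv h0 h1 hwL hwc
  have huZ : ∀ t, renewalConv ρ w t = renewalConv ρ z (t + δ) - renewalConv ρ z t := fun t => by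
    rw [renewalConv, renewalConv, renewalConv, ← integral_sub (hzi _) (hzi _)]
    simp only [hw, sub_add_eq_add_sub]
  set u := renewalConv ρ w with hu
  have hbu : IsBoundedUnder (· ≤ ·) atTop u := isBoundedUnder_of ⟨B, fun t => (abs_le.1 (hB t)).2⟩
  have hbl : IsBoundedUnder (· ≥ ·) atTop u := isBoundedUnder_of ⟨-B, fun t => (abs_le.1 (hB t)).1⟩
  have hlim : limsup u atTop ≤ 0 := by
    have ha : ∀ η > 0, ∀ᶠ t in atTop, u t < limsup u atTop + η := fun η hη =>
      eventually_lt_of_limsup_lt (lt_add_of_pos_right _ hη) hbu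
    have hcl : MapClusterPt (limsup u atTop) atTop u := by
      rw [mapClusterPt_iff_frequently]
      intro s hs
      obtain ⟨ε, hε, hs⟩ := Metric.mem_nhds_iff.1 hs
      have h2 := frequently_lt_of_lt_limsup hbl.isCoboundedUnder_le (sub_lt_self (limsup u atTop) hε)
      refine (h2.and_eventually (ha ε hε)).mono fun t ht => hs ?_
      rw [Metric.mem_ball, Real.dist_eq, abs_lt]
      constructor <;> linarith [ht.1, ht.2]
    obtain ⟨t, hta, ht⟩ := hcl.exists_seq_tendsto
    refine upper_limit_nonpos_of_bounded_sum (ρ := ρ) (L := L) hδ hB' huZ h0 hρ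
      (measurable_renewalConv hwL.continuous) hB hL ?_ (fun η hη => (ha η hη).mono fun _ h => h.le)
      ht hta
    obtain ⟨R, hR0, hR⟩ := hwc.exists_eq_zero_of_lt_abs
    filter_upwards [eventually_gt_atTop R] with t ht
    rw [hu, renewalConv_eq h0 h1 hwL.continuous hwc, hR t (ht.trans_le (le_abs_self t)), zero_add]
  filter_upwards [eventually_lt_of_limsup_lt (hlim.trans_lt hη) hbu] with t ht
  rw [← huZ]
  exact ht.le

theorem tendsto_renewalConv_sub (h0 : ρ (Set.Iio 0) = 0) (h1 : ρ (Set.Ioi 0) ≠ 0)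
    (hρ : IsNonarithmetic ρ) (hz : LipschitzWith K z) (hzc : HasCompactSupport z) {δ : ℝ}
    (hδ : 0 < δ) :
    Tendsto (fun t => renewalConv ρ z (t + δ) - renewalConv ρ z t) atTop (𝓝 0) := by
  have hneg : ∀ t, renewalConv ρ (-z) t = - renewalConv ρ z t := fun t => by
    simp [renewalConv, integral_neg]
  rw [Metric.tendsto_nhds]
  intro η hη
  filter_upwards [eventually_renewalConv_sub_le h0 h1 hρ hz hzc hδ (half_pos hη),
    eventually_renewalConv_sub_le h0 h1 hρ hz.neg hzc.neg hδ (half_pos hη)] with t h1 h2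
  rw [hneg, hneg] at h2
  rw [Real.dist_eq, sub_zero, abs_lt]
  constructor <;> linarith

/-- By Tonelli the tail can be convolved with the renewal measure first, which gives the indicator
of `[0, ∞)`. Once `t` exceeds the radius of the support of `z`, this indicator cuts off nothing. -/
theorem lintegral_tail_mul_renewalConv (h0 : ρ (Set.Iio 0) = 0) (h1 : ρ (Set.Ioi 0) ≠ 0)
    (hz : Continuous z) (hzc : HasCompactSupport z) (hz0 : ∀ x, 0 ≤ z x) :
    ∀ᶠ t in atTop, ∫⁻ x, tail ρ x * ENNReal.ofReal (renewalConv ρ z (t - x))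
      = ∫⁻ x, ENNReal.ofReal (z x) := by
  obtain ⟨hi, -⟩ := integrable_and_bounded_renewalConv h0 h1 hz hzc
  obtain ⟨R, hR0, hR⟩ := hzc.exists_eq_zero_of_lt_abs
  filter_upwards [eventually_gt_atTop R] with t ht
  have hm : Measurable (tail ρ) := measurable_tail
  calc ∫⁻ x, tail ρ x * ENNReal.ofReal (renewalConv ρ z (t - x))
      = ∫⁻ x, ∫⁻ s, tail ρ x * ENNReal.ofReal (z (t - x - s)) ∂(renewalMeasure ρ) := by
        refine lintegral_congr fun x => ?_
        rw [lintegral_const_mul _ (by fun_prop), renewalConv,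
          ofReal_integral_eq_lintegral_ofReal (hi _) (ae_of_all _ fun _ => hz0 _)]
    _ = ∫⁻ s, (∫⁻ x, tail ρ x * ENNReal.ofReal (z (t - x - s))) ∂(renewalMeasure ρ) :=
        lintegral_lintegral_swap (by fun_prop)
    _ = ∫⁻ s, (∫⁻ v, tail ρ (v - s) * ENNReal.ofReal (z (t - v))) ∂(renewalMeasure ρ) := by
        refine lintegral_congr fun s => ?_
        rw [← lintegral_sub_right_eq_self _ s]
        refine lintegral_congr fun v => ?_
        rw [sub_sub, sub_add_cancel]
    _ = ∫⁻ v, ∫⁻ s, tail ρ (v - s) * ENNReal.ofReal (z (t - v)) ∂(renewalMeasure ρ) :=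
        lintegral_lintegral_swap (by fun_prop)
    _ = ∫⁻ v, ENNReal.ofReal (z (t - v)) := by
        refine lintegral_congr fun v => ?_
        rw [lintegral_mul_const _ (by fun_prop), lintegral_tail_renewalMeasure h0 h1]
        by_cases hv : 0 ≤ v
        · simp [hv]
        · rw [hR (t - v) ((by linarith : R < t - v).trans_le (le_abs_self _))]; simp
    _ = ∫⁻ x, ENNReal.ofReal (z x) := lintegral_sub_left_eq_self (fun x => ENNReal.ofReal (z x)) t

/-- Blackwell's renewal theorem, in smoothed form. -/
theorem tendsto_renewalConv (h0 : ρ (Set.Iio 0) = 0) (h1 : ρ (Set.Ioi 0) ≠ 0)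
    (hρ : IsNonarithmetic ρ) {μ : ℝ} (hμ0 : 0 < μ) (hμ : ∫⁻ x, tail ρ x = ENNReal.ofReal μ)
    (hz : LipschitzWith K z) (hzc : HasCompactSupport z) (hz0 : ∀ x, 0 ≤ z x) :
    Tendsto (renewalConv ρ z) atTop (𝓝 ((∫ x, z x) / μ)) := by
  obtain ⟨hi, B, hB⟩ := integrable_and_bounded_renewalConv h0 h1 hz.continuous hzc
  have hZ0 : ∀ t, 0 ≤ renewalConv ρ z t := fun t => integral_nonneg fun _ => hz0 _
  have hZm := measurable_renewalConv (ρ := ρ) hz.continuous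
  have hZmt : ∀ t, Measurable fun x => renewalConv ρ z (t - x) := fun t =>
    hZm.comp (measurable_const.sub measurable_id)
  have htm : Measurable (tail ρ) := measurable_tail
  have htop : ∀ x, tail ρ x ≠ ∞ := fun x => ((tail_le_one x).trans_lt ENNReal.one_lt_top).ne
  have hti : Integrable (fun x => (tail ρ x).toReal) :=
    integrable_toReal_of_lintegral_ne_top htm.aemeasurable (by rw [hμ]; exact ENNReal.ofReal_ne_top)
  have htμ : ∫ x, (tail ρ x).toReal = μ := by
    rw [integral_toReal htm.aemeasurable (ae_of_all _ fun x => (htop x).lt_top), hμ,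
      ENNReal.toReal_ofReal hμ0.le]
  have hprod : ∀ t, Integrable (fun x => (tail ρ x).toReal * renewalConv ρ z (t - x)) := fun t =>
    hti.mul_bdd (c := B) (hZmt t).aestronglyMeasurable (ae_of_all _ fun x => hB _)
  have hconv : ∀ᶠ t in atTop, ∫ x, (tail ρ x).toReal * renewalConv ρ z (t - x) = ∫ x, z x := by
    filter_upwards [lintegral_tail_mul_renewalConv h0 h1 hz.continuous hzc hz0] with t ht
    rw [integral_eq_lintegral_of_nonneg_ae (ae_of_all _ fun x =>
      mul_nonneg ENNReal.toReal_nonneg (hZ0 _)) (hprod t).aestronglyMeasurable,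
      integral_eq_lintegral_of_nonneg_ae (ae_of_all _ hz0) hz.continuous.aestronglyMeasurable, ← ht]
    congr 1
    refine lintegral_congr fun x => ?_
    rw [ENNReal.ofReal_mul ENNReal.toReal_nonneg, ENNReal.ofReal_toReal (htop x)]
  -- Since `Z t - Z (t - x) → 0` for each fixed `x` and the tail is integrable, `Z (t - x)` may be
  -- replaced by `Z t` under the integral. This turns the exact identity `hconv` into `μ Z(t) → ∫
  -- z`.
  have hdiff : Tendsto (fun t => ∫ x, (tail ρ x).toReal *
      (renewalConv ρ z t - renewalConv ρ z (t - x))) atTop (𝓝 (∫ _ : ℝ, (0 : ℝ))) := by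
    refine tendsto_integral_filter_of_dominated_convergence
      (fun x => (tail ρ x).toReal * (2 * B)) (Eventually.of_forall fun t => by fun_prop)
      (Eventually.of_forall fun t => ae_of_all _ fun x => ?_) (hti.mul_const _)
      (ae_of_all _ fun x => ?_)
    · rw [norm_mul, Real.norm_of_nonneg ENNReal.toReal_nonneg, Real.norm_eq_abs]
      refine mul_le_mul_of_nonneg_left ?_ ENNReal.toReal_nonneg
      refine (abs_sub _ _).trans ?_
      linarith [hB t, hB (t - x)]
    · rw [← mul_zero (tail ρ x).toReal]
      refine Tendsto.const_mul _ ?_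
      rcases lt_trichotomy x 0 with hx | rfl | hx
      · have := (tendsto_renewalConv_sub h0 h1 hρ hz hzc (neg_pos.2 hx)).neg
        simpa [← sub_eq_add_neg] using this
      · simp
      · have := (tendsto_renewalConv_sub h0 h1 hρ hz hzc hx).comp
          (tendsto_atTop_add_const_right atTop (-x) tendsto_id)
        simpa [Function.comp_def, ← sub_eq_add_neg] using this
  rw [integral_zero] at hdiff
  have hμZ : Tendsto (fun t => μ * renewalConv ρ z t) atTop (𝓝 (∫ x, z x)) := by
    have h2 := hdiff.add_const (∫ x, z x)
    rw [zero_add] at h2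
    refine h2.congr' ?_
    filter_upwards [hconv] with t ht
    rw [← ht, ← htμ, ← integral_mul_const, ← integral_add _ (hprod t)]
    · refine integral_congr_ae (ae_of_all _ fun x => ?_)
      simp only; ring
    · simp_rw [mul_sub]
      exact (hti.mul_const _).sub (hprod t)
  have := hμZ.const_mul μ⁻¹
  simpa [← mul_assoc, inv_mul_cancel₀ hμ0.ne', div_eq_inv_mul] using this

end Blackwell

/-! ### Approximation from below and the key renewal bound -/

/-- A right-continuous function on the line has at most countably many discontinuities. -/
theorem countable_setOf_not_continuousAt_of_right_continuous {h : ℝ → ℝ}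
    (hr : ∀ x, ContinuousWithinAt h (Set.Ici x) x) : {x | ¬ ContinuousAt h x}.Countable := by
  set D : ℕ → Set ℝ := fun n => {x | ¬ ∃ δ > 0, ∀ y ∈ Metric.ball x δ, ∀ z ∈ Metric.ball x δ,
    |h y - h z| < 1 / ((n : ℝ) + 1)} with hD
  have hsub : {x | ¬ ContinuousAt h x} ⊆ ⋃ n, D n := by
    intro x hx
    by_contra hcon
    refine hx ?_
    simp only [Set.mem_iUnion, not_exists] at hcon
    rw [Metric.continuousAt_iff]
    intro ε hε
    obtain ⟨n, hn⟩ := exists_nat_one_div_lt hε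
    obtain ⟨δ, hδ, hx'⟩ := not_not.1 (hcon n)
    exact ⟨δ, hδ, fun y hy => (hx' y hy x (Metric.mem_ball_self hδ)).trans hn⟩
  refine (Set.countable_iUnion fun n => ?_).mono hsub
  -- Each point of `D n` is isolated in `D n` from the right: just to the right of `x` the values
  -- lie within half of `1 / (n + 1)` of `h x`, so they oscillate by less than `1 / (n + 1)`.
  refine Set.Countable.mono (fun x hx => ?_) (countable_setOfPred_isolated_right_within (s := D n))
  refine ⟨hx, ?_⟩
  have hpos : (0 : ℝ) < 1 / ((n : ℝ) + 1) / 2 := by positivity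
  obtain ⟨r, hr0, hr'⟩ := Metric.continuousWithinAt_iff.1 (hr x) _ hpos
  rw [← empty_mem_iff_bot]
  have h1 : Set.Ioo x (x + r) ∈ 𝓝[D n ∩ Set.Ioi x] x :=
    nhdsWithin_mono x Set.inter_subset_right (Ioo_mem_nhdsGT (by linarith))
  filter_upwards [h1, self_mem_nhdsWithin] with y hy hyD
  refine hyD.1 ⟨min (y - x) (x + r - y), lt_min (by linarith [hy.1]) (by linarith [hy.2]), ?_⟩
  have key : ∀ v ∈ Metric.ball y (min (y - x) (x + r - y)),
      |h v - h x| < 1 / ((n : ℝ) + 1) / 2 := fun v hv => by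
    rw [Metric.mem_ball, Real.dist_eq, lt_min_iff, abs_lt, abs_lt] at hv
    refine hr' (show x ≤ v by linarith [hv.1.1]) ?_
    rw [Real.dist_eq, abs_lt]
    constructor <;> linarith [hv.1.1, hv.2.2]
  intro v hv w hw
  have h2 := abs_lt.1 (key v hv)
  have h3 := abs_lt.1 (key w hw)
  rw [abs_lt]
  constructor <;> linarith [h2.1, h2.2, h3.1, h3.2]

/-- The largest `K`-Lipschitz function below a nonnegative function. -/
noncomputable def lipschitzEnvelope (h : ℝ → ℝ) (K : ℝ≥0) (x : ℝ) : ℝ := ⨅ y, (h y + K * |x - y|)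

section Envelope

variable {h : ℝ → ℝ}

theorem bddBelow_range_lipschitzEnvelope (h0 : ∀ x, 0 ≤ h x) (K : ℝ≥0) (x : ℝ) :
    BddBelow (Set.range fun y => h y + K * |x - y|) :=
  ⟨0, by rintro _ ⟨y, rfl⟩; exact add_nonneg (h0 y) (by positivity)⟩

theorem lipschitzEnvelope_nonneg (h0 : ∀ x, 0 ≤ h x) (K : ℝ≥0) (x : ℝ) :
    0 ≤ lipschitzEnvelope h K x :=
  le_ciInf fun y => add_nonneg (h0 y) (by positivity)

theorem lipschitzEnvelope_le (h0 : ∀ x, 0 ≤ h x) (K : ℝ≥0) (x : ℝ) :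
    lipschitzEnvelope h K x ≤ h x :=
  (ciInf_le (bddBelow_range_lipschitzEnvelope h0 K x) x).trans (by simp)

theorem lipschitzWith_lipschitzEnvelope (h0 : ∀ x, 0 ≤ h x) (K : ℝ≥0) :
    LipschitzWith K (lipschitzEnvelope h K) := by
  refine LipschitzWith.of_le_add_mul K fun x x' => ?_
  rw [← sub_le_iff_le_add]
  refine le_ciInf fun y => ?_
  rw [sub_le_iff_le_add]
  refine (ciInf_le (bddBelow_range_lipschitzEnvelope h0 K x) y).trans ?_
  have := mul_le_mul_of_nonneg_left (abs_sub_le x x' y) K.2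
  rw [Real.dist_eq]
  have e : (K : ℝ) * (|x - x'| + |x' - y|) = K * |x - x'| + K * |x' - y| := by ring
  linarith [show (K : ℝ) * |x - y| ≤ K * (|x - x'| + |x' - y|) from this]

/-- Near `x` the values of `h` are almost `h x` by continuity. Points at distance at least `δ` pay a
penalty `n δ`, which exceeds `h x` for large `n`, and there `h ≥ 0` suffices. -/
theorem tendsto_lipschitzEnvelope (h0 : ∀ x, 0 ≤ h x) {x : ℝ} (hx : ContinuousAt h x) :
    Tendsto (fun n : ℕ => lipschitzEnvelope h n x) atTop (𝓝 (h x)) := by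
  rw [Metric.tendsto_atTop]
  intro ε hε
  obtain ⟨δ, hδ, hx'⟩ := Metric.continuousAt_iff.1 hx (ε / 2) (half_pos hε)
  obtain ⟨N, hN⟩ := exists_nat_ge (h x / δ)
  rw [div_le_iff₀ hδ] at hN
  refine ⟨N, fun n hn => ?_⟩
  have h1 : h x - ε / 2 ≤ lipschitzEnvelope h n x := by
    refine le_ciInf fun y => ?_
    rcases lt_or_ge |x - y| δ with hy | hy
    · have := hx' (show dist y x < δ by rwa [Real.dist_eq, abs_sub_comm])
      rw [Real.dist_eq, abs_lt] at this
      have h2 : (0 : ℝ) ≤ ((n : ℝ≥0) : ℝ) * |x - y| := by positivity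
      linarith [this.1]
    · have h2 : (N : ℝ) * δ ≤ ((n : ℝ≥0) : ℝ) * |x - y| := by
        have : (N : ℝ) ≤ n := by exact_mod_cast hn
        simp only [NNReal.coe_natCast]
        gcongr
      linarith [h0 y]
  rw [Real.dist_eq, abs_lt]
  constructor <;> linarith [lipschitzEnvelope_le h0 n x]

/-- An integrable nonnegative right-continuous function can be approximated in mean from below by
compactly supported Lipschitz functions. -/
theorem exists_lipschitz_le (h0 : ∀ x, 0 ≤ h x) (hi : Integrable h)
    (hr : ∀ x, ContinuousWithinAt h (Set.Ici x) x) {c : ℝ} (hc : c < ∫ x, h x) :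
    ∃ (K : ℝ≥0) (z : ℝ → ℝ), LipschitzWith K z ∧ HasCompactSupport z ∧ (∀ x, 0 ≤ z x) ∧
      (∀ x, z x ≤ h x) ∧ c < ∫ x, z x := by
  -- The tent forces compact support, and at a fixed point it is inactive once `n ≥ h x + |x|`.
  set z : ℕ → ℝ → ℝ := fun n x => min (lipschitzEnvelope h n x) (max (n - |x|) 0) with hz
  have hzL : ∀ n : ℕ, LipschitzWith (max (n : ℝ≥0) (max 1 0)) (z n) := fun n => by
    refine (lipschitzWith_lipschitzEnvelope h0 n).min (LipschitzWith.max ?_ (LipschitzWith.const 0))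
    refine LipschitzWith.of_le_add fun x y => ?_
    have := abs_sub_abs_le_abs_sub y x
    rw [abs_sub_comm] at this
    rw [Real.dist_eq]
    linarith
  have hz0 : ∀ n x, 0 ≤ z n x := fun n x =>
    le_min (lipschitzEnvelope_nonneg h0 _ _) (le_max_right _ _)
  have hzh : ∀ n x, z n x ≤ h x := fun n x => (min_le_left _ _).trans (lipschitzEnvelope_le h0 _ _)
  have hlim : Tendsto (fun n => ∫ x, z n x) atTop (𝓝 (∫ x, h x)) := by
    refine tendsto_integral_of_dominated_convergence h
      (fun n => (hzL n).continuous.aestronglyMeasurable) hi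
      (fun n => ae_of_all _ fun x => ?_) ?_
    · rw [Real.norm_of_nonneg (hz0 n x)]; exact hzh n x
    · have hcount := countable_setOf_not_continuousAt_of_right_continuous hr
      filter_upwards [hcount.ae_notMem volume] with x hx
      refine (tendsto_lipschitzEnvelope h0 (not_not.1 hx)).congr' ?_
      obtain ⟨N, hN⟩ := exists_nat_ge (h x + |x|)
      filter_upwards [eventually_ge_atTop N] with n hn
      have : (N : ℝ) ≤ n := by exact_mod_cast hn
      refine (min_eq_left ?_).symm
      refine le_max_of_le_left ?_
      linarith [lipschitzEnvelope_le h0 n x]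
  obtain ⟨n, hn⟩ := (hlim.eventually (lt_mem_nhds hc)).exists
  refine ⟨_, z n, hzL n, ?_, hz0 n, hzh n, hn⟩
  refine HasCompactSupport.intro (isCompact_closedBall (0 : ℝ) n) fun x hx => ?_
  rw [mem_closedBall_zero_iff, Real.norm_eq_abs, not_le] at hx
  refine le_antisymm ((min_le_right _ _).trans ?_) (hz0 n x)
  exact max_le (by linarith) le_rfl

end Envelope

/-- Lower bound in the key renewal theorem. -/
theorem eventually_le_lintegral_renewalMeasure {ρ : Measure ℝ} [IsProbabilityMeasure ρ]
    (h0 : ρ (Set.Iio 0) = 0) (h1 : ρ (Set.Ioi 0) ≠ 0) (hρ : IsNonarithmetic ρ) {μ : ℝ}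
    (hμ0 : 0 < μ) (hμ : ∫⁻ x, tail ρ x = ENNReal.ofReal μ) {h : ℝ → ℝ} (hh : ∀ x, 0 ≤ h x)
    (hi : Integrable h) (hr : ∀ x, ContinuousWithinAt h (Set.Ici x) x) {c : ℝ}
    (hc : c < (∫ x, h x) / μ) :
    ∀ᶠ t in atTop, ENNReal.ofReal c ≤ ∫⁻ s, ENNReal.ofReal (h (t - s)) ∂(renewalMeasure ρ) := by
  rw [lt_div_iff₀ hμ0] at hc
  obtain ⟨K, z, hzL, hzc, hz0, hzh, hz⟩ := exists_lipschitz_le hh hi hr hc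
  rw [← lt_div_iff₀ hμ0] at hz
  filter_upwards [(tendsto_renewalConv h0 h1 hρ hμ0 hμ hzL hzc hz0).eventually (lt_mem_nhds hz)]
    with t ht
  refine (ENNReal.ofReal_le_ofReal ht.le).trans ?_
  rw [renewalConv, ofReal_integral_eq_lintegral_ofReal
    ((integrable_and_bounded_renewalConv h0 h1 hzL.continuous hzc).1 t)
    (ae_of_all _ fun _ => hz0 _)]
  exact lintegral_mono fun s => ENNReal.ofReal_le_ofReal (hzh _)

/-! ### Cycles -/

/-- The point of the lattice `(j + 1)⁻¹ ℤ` that follows `u`. -/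
noncomputable def rightApprox (j : ℕ) (u : ℝ) : ℝ := (⌊u * (j + 1)⌋ + 1) / (j + 1)

theorem lt_rightApprox (j : ℕ) (u : ℝ) : u < rightApprox j u := by
  rw [rightApprox, lt_div_iff₀ (by positivity)]
  exact Int.lt_floor_add_one _

theorem rightApprox_le (j : ℕ) (u : ℝ) : rightApprox j u ≤ u + 1 / (j + 1) := by
  have : (0 : ℝ) < j + 1 := by positivity
  rw [rightApprox, div_le_iff₀ this, add_mul, one_div, inv_mul_cancel₀ this.ne']
  linarith [Int.floor_le (u * (j + 1))]

theorem tendsto_rightApprox (u : ℝ) :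
    Tendsto (fun j => rightApprox j u) atTop (𝓝[Set.Ici u] u) := by
  refine tendsto_nhdsWithin_iff.2 ⟨?_, Eventually.of_forall fun j => (lt_rightApprox j u).le⟩
  have h : Tendsto (fun j : ℕ => u + 1 / ((j : ℝ) + 1)) atTop (𝓝 (u + 0)) :=
    tendsto_const_nhds.add tendsto_one_div_add_atTop_nhds_zero_nat
  rw [add_zero] at h
  exact tendsto_of_tendsto_of_tendsto_of_le_of_le tendsto_const_nhds h
    (fun j => (lt_rightApprox j u).le) (fun j => rightApprox_le j u)

/-- A function of a discretized real variable and another variable is jointly measurable. -/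
theorem measurable_comp_rightApprox {S β : Type*} [MeasurableSpace S] [MeasurableSpace β]
    {g : ℝ → S → β} (hg : ∀ u, Measurable (g u)) (j : ℕ) :
    Measurable fun p : ℝ × S => g (rightApprox j p.1) p.2 := by
  have h : Measurable fun p : ℤ × S => g ((p.1 + 1) / (j + 1)) p.2 :=
    measurable_from_prod_countable_right fun k => hg ((k + 1) / (j + 1))
  exact h.comp (((Int.measurable_floor.comp (measurable_id.mul_const _)).comp
    measurable_fst).prodMk measurable_snd)

section Cycles

variable {Ω : Type*} {m : ℕ} {E : Fin m → Type*}

/-- The space of cycles of all components. -/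
abbrev CycleSpace (E : Fin m → Type*) := ∀ i, (ℝ≥0 → E i) × ℝ

/-- The contribution `g (X u) 1{0 ≤ u < T}` of a cycle `(X, T)` of component `i`. -/
noncomputable def cycleValue (i : Fin m) (g : E i → ℝ≥0∞) (u : ℝ) (c : CycleSpace E) : ℝ≥0∞ :=
  (Set.Ico 0 (c i).2).indicator (fun u => g ((c i).1 u.toNNReal)) u

/-- The mean contribution `E [g (X u); 0 ≤ u < T]` of a cycle of component `i`. -/
noncomputable def meanValue [MeasurableSpace Ω] (P : Measure Ω) (C : ℕ → Ω → CycleSpace E)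
    (i : Fin m) (g : E i → ℝ≥0∞) (u : ℝ) : ℝ≥0∞ :=
  ∫⁻ ω, cycleValue i g u (C 0 ω) ∂P

theorem cycleValue_of {i : Fin m} {g : E i → ℝ≥0∞} {u : ℝ} {c : CycleSpace E} (h0 : 0 ≤ u)
    (h : u < (c i).2) : cycleValue i g u c = g ((c i).1 u.toNNReal) :=
  Set.indicator_of_mem (show u ∈ Set.Ico 0 (c i).2 from ⟨h0, h⟩) _

theorem cycleValue_eq_zero {i : Fin m} {g : E i → ℝ≥0∞} {u : ℝ} {c : CycleSpace E}
    (h : ¬ (0 ≤ u ∧ u < (c i).2)) : cycleValue i g u c = 0 :=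
  Set.indicator_of_notMem (show u ∉ Set.Ico 0 (c i).2 from h) _

theorem cycleValue_le (i : Fin m) {g : E i → ℝ≥0∞} {M : ℝ≥0∞} (hM : ∀ x, g x ≤ M) (u : ℝ)
    (c : CycleSpace E) : cycleValue i g u c ≤ M :=
  Set.indicator_apply_le' (fun _ => hM _) fun _ => zero_le

theorem measurable_cycleValue [∀ i, MeasurableSpace (E i)] (i : Fin m) {g : E i → ℝ≥0∞}
    (hg : Measurable g) (u : ℝ) : Measurable (cycleValue (E := E) i g u) := by
  have h1 : Measurable fun c : CycleSpace E => (c i).2 := measurable_snd.comp (measurable_pi_apply i)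
  have h2 : Measurable fun c : CycleSpace E => (c i).1 u.toNNReal :=
    (measurable_pi_apply _).comp (measurable_fst.comp (measurable_pi_apply i))
  have hS : MeasurableSet {c : CycleSpace E | 0 ≤ u ∧ u < (c i).2} :=
    (MeasurableSet.const _).inter (measurableSet_lt measurable_const h1)
  exact (hg.comp h2).indicator hS

/-- For the product sigma-algebra on paths, evaluation at a random time need not be measurable. At
times rounded to a countable lattice it is, and rounding to the right lets right continuity recover
the true value in the limit. -/
theorem measurable_path_rightApprox [∀ i, MeasurableSpace (E i)] {α : Type*} [MeasurableSpace α]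
    (i : Fin m) {Z : α → CycleSpace E} {a : α → ℝ} (hZ : Measurable Z) (ha : Measurable a) (j : ℕ) :
    Measurable fun x => (Z x i).1 (rightApprox j (a x)).toNNReal := by
  have h : Measurable fun p : ℝ × CycleSpace E => (p.2 i).1 (rightApprox j p.1).toNNReal :=
    measurable_comp_rightApprox (g := fun u (c : CycleSpace E) => (c i).1 u.toNNReal) (fun u =>
      (measurable_pi_apply _).comp (measurable_fst.comp (measurable_pi_apply i))) j
  exact h.comp (ha.prodMk hZ)

theorem measurable_cycleValue_rightApprox [∀ i, MeasurableSpace (E i)] {α : Type*}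
    [MeasurableSpace α] (i : Fin m) {g : E i → ℝ≥0∞} (hg : Measurable g) {Z : α → CycleSpace E}
    {a : α → ℝ} (hZ : Measurable Z) (ha : Measurable a) (j : ℕ) :
    Measurable fun x => cycleValue i g (rightApprox j (a x)) (Z x) := by
  have h : Measurable fun p : ℝ × CycleSpace E => cycleValue i g (rightApprox j p.1) p.2 :=
    measurable_comp_rightApprox (g := cycleValue i g) (measurable_cycleValue i hg) j
  have h' : Measurable fun x => (a x, Z x) := ha.prodMk hZ
  have h'' := h.comp h'
  exact h''

section Topology

variable [∀ i, MetricSpace (E i)]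

theorem tendsto_toNNReal_rightApprox (u : ℝ) :
    Tendsto (fun j => (rightApprox j u).toNNReal) atTop (𝓝[Set.Ici u.toNNReal] u.toNNReal) := by
  refine tendsto_nhdsWithin_iff.2 ⟨(continuous_real_toNNReal.tendsto u).comp
    ((tendsto_rightApprox u).mono_right nhdsWithin_le_nhds), Eventually.of_forall fun j => ?_⟩
  exact Real.toNNReal_le_toNNReal (lt_rightApprox j u).le

theorem tendsto_path_rightApprox {i : Fin m} {c : CycleSpace E}
    (hc : ∀ s : ℝ≥0, ContinuousWithinAt (c i).1 (Set.Ici s) s) (u : ℝ) :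
    Tendsto (fun j => (c i).1 (rightApprox j u).toNNReal) atTop (𝓝 ((c i).1 u.toNNReal)) :=
  (hc _).tendsto.comp (tendsto_toNNReal_rightApprox u)

/-- The lifetime `[0, T)` is closed on the left and open on the right, so its indicator is right
continuous like the path. -/
theorem continuousWithinAt_cycleValue {i : Fin m} {g : E i → ℝ≥0∞} (hg : Continuous g)
    {c : CycleSpace E} (hc : ∀ s : ℝ≥0, ContinuousWithinAt (c i).1 (Set.Ici s) s) (u : ℝ) :
    ContinuousWithinAt (fun u => cycleValue i g u c) (Set.Ici u) u := by
  by_cases h : 0 ≤ u ∧ u < (c i).2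
  · have h1 : ContinuousWithinAt (fun u : ℝ => g ((c i).1 u.toNNReal)) (Set.Ici u) u := by
      refine hg.continuousAt.comp_continuousWithinAt ?_
      refine (hc u.toNNReal).comp continuous_real_toNNReal.continuousWithinAt fun v hv => ?_
      exact Real.toNNReal_le_toNNReal hv
    refine h1.congr_of_eventuallyEq ?_ (cycleValue_of h.1 h.2)
    have h2 : Set.Iio (c i).2 ∈ 𝓝[Set.Ici u] u := nhdsWithin_le_nhds (Iio_mem_nhds h.2)
    filter_upwards [h2, self_mem_nhdsWithin] with v hv hv'
    exact cycleValue_of (h.1.trans hv') hv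
  · refine (continuousWithinAt_const (b := (0 : ℝ≥0∞))).congr_of_eventuallyEq ?_
      (cycleValue_eq_zero h)
    rcases not_and_or.1 h with h | h
    · have h2 : Set.Iio (0 : ℝ) ∈ 𝓝[Set.Ici u] u := nhdsWithin_le_nhds (Iio_mem_nhds (not_le.1 h))
      filter_upwards [h2] with v hv
      exact cycleValue_eq_zero fun h' => absurd hv (not_lt.2 h'.1)
    · filter_upwards [self_mem_nhdsWithin] with v hv
      exact cycleValue_eq_zero fun h' => absurd h'.2 (not_lt.2 ((not_lt.1 h).trans hv))

end Topology

section Past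

variable [∀ i, MeasurableSpace (E i)]

/-- The sigma-algebra generated by the first `n` cycles of all components. -/
@[reducible] def past (C : ℕ → Ω → CycleSpace E) (n : ℕ) : MeasurableSpace Ω :=
  MeasurableSpace.comap (fun ω (k : Finset.range n) => C k ω) MeasurableSpace.pi

variable {C : ℕ → Ω → CycleSpace E}

theorem measurable_past {k n : ℕ} (h : k < n) : Measurable[past C n] (C k) :=
  (measurable_pi_apply (⟨k, Finset.mem_range.2 h⟩ : Finset.range n)).comp
    (comap_measurable fun ω (k : Finset.range n) => C k ω)

theorem past_mono {k n : ℕ} (h : k ≤ n) : past C k ≤ past C n := by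
  refine Measurable.comap_le ?_
  exact @measurable_pi_lambda _ _ _ (past C n) _ _ fun l =>
    measurable_past ((Finset.mem_range.1 l.2).trans_le h)

theorem measurable_epoch_past (i : Fin m) {k n : ℕ} (h : k ≤ n) :
    Measurable[past C n] (epoch C i k) := by
  refine @Finset.measurable_sum _ _ _ _ _ _ (past C n) _ _ fun l hl => ?_
  have h1 : Measurable fun c : CycleSpace E => (c i).2 := measurable_snd.comp (measurable_pi_apply i)
  exact h1.comp (measurable_past ((Finset.mem_range.1 hl).trans_le h))

variable [MeasurableSpace Ω] {P : Measure Ω}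

theorem past_le (hC : ∀ n, Measurable (C n)) (n : ℕ) : past C n ≤ ‹MeasurableSpace Ω› :=
  Measurable.comap_le (measurable_pi_lambda _ fun _ => hC _)

theorem indep_past (hC : ∀ n, Measurable (C n)) (hi : iIndepFun C P) (n : ℕ) :
    Indep (past C n) (MeasurableSpace.comap (C n) inferInstance) P := by
  have h := hi.indepFun_finset (Finset.range n) {n} (by simp) hC
  have h2 := h.comp measurable_id
    (measurable_pi_apply (⟨n, Finset.mem_singleton_self n⟩ : ({n} : Finset ℕ)))
  exact (IndepFun_iff_Indep _ _ _).1 h2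

end Past

end Cycles

/-! ### Independence of a cycle from its past -/

section CycleSequence

variable {Ω : Type*} {m : ℕ} {E : Fin m → Type*} [MeasurableSpace Ω] [∀ i, MetricSpace (E i)]
  [∀ i, MeasurableSpace (E i)] {P : Measure Ω} {C : ℕ → Ω → CycleSpace E}

/-- The law of the cycle lengths of component `i`. -/
noncomputable def lengthLaw (P : Measure Ω) (C : ℕ → Ω → CycleSpace E) (i : Fin m) : Measure ℝ :=
  P.map fun ω => (C 0 ω i).2

namespace IsCycleSequence

section Basic

theorem measurable_length (hC : IsCycleSequence P C)
    (n : ℕ) (i : Fin m) : Measurable fun ω => (C n ω i).2 :=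
  measurable_snd.comp ((measurable_pi_apply i).comp (hC.measurable n))

theorem map_eq (hC : IsCycleSequence P C)
    (n : ℕ) : P.map (C n) = P.map (C 0) := (hC.identDistrib n).map_eq

theorem measurable_epoch (hC : IsCycleSequence P C)
    (i : Fin m) (n : ℕ) : Measurable (epoch C i n) :=
  (measurable_epoch_past i le_rfl).mono (past_le hC.measurable n) le_rfl

theorem identDistrib_length (hC : IsCycleSequence P C) (n : ℕ) (i : Fin m) :
    IdentDistrib (fun ω => (C n ω i).2) (fun ω => (C 0 ω i).2) P P :=
  (hC.identDistrib n).comp (u := fun c : CycleSpace E => (c i).2)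
    (measurable_snd.comp (measurable_pi_apply i))

theorem ae_nonneg (hC : IsCycleSequence P C) (i : Fin m) : ∀ᵐ ω ∂P, ∀ n, 0 ≤ (C n ω i).2 := by
  refine ae_all_iff.2 fun n => ?_
  exact (hC.identDistrib_length n i).symm.ae_snd (p := fun x => 0 ≤ x) measurableSet_Ici
    (hC.nonneg i)

theorem lengthLaw_Iio (hC : IsCycleSequence P C)
    (i : Fin m) : lengthLaw P C i (Set.Iio 0) = 0 := by
  rw [lengthLaw, Measure.map_apply (hC.measurable_length 0 i) measurableSet_Iio]
  refine measure_mono_null (fun ω hω => ?_) (ae_iff.1 (hC.nonneg i))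
  simpa using hω

theorem lengthLaw_Ioi (hC : IsCycleSequence P C)
    (i : Fin m) : lengthLaw P C i (Set.Ioi 0) ≠ 0 := by
  intro h
  rw [lengthLaw, Measure.map_apply (hC.measurable_length 0 i) measurableSet_Ioi] at h
  have hle : ∀ᵐ ω ∂P, (C 0 ω i).2 ≤ 0 := by
    rw [ae_iff]
    refine measure_mono_null (fun ω hω => ?_) h
    simpa using hω
  exact absurd (hC.mean_pos i) (not_lt.2 (integral_nonpos_of_ae hle))

/-- The layer-cake formula; this identifies the constant `μ` of Blackwell's theorem with the mean
cycle length. -/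
theorem lintegral_tail (hC : IsCycleSequence P C) (i : Fin m) :
    ∫⁻ x, tail (lengthLaw P C i) x = ENNReal.ofReal (meanCycle P C i) := by
  rw [meanCycle, ofReal_integral_eq_lintegral_ofReal (hC.integrable i) (hC.nonneg i),
    lintegral_eq_lintegral_meas_lt P (hC.nonneg i) (hC.measurable_length 0 i).aemeasurable]
  unfold tail
  rw [lintegral_indicator measurableSet_Ici, setLIntegral_congr Ioi_ae_eq_Ici.symm]
  refine lintegral_congr fun x => ?_
  rw [lengthLaw, Measure.map_apply (hC.measurable_length 0 i) measurableSet_Ioi]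
  rfl

theorem ae_tendsto_epoch_div (hC : IsCycleSequence P C) (i : Fin m) :
    ∀ᵐ ω ∂P, Tendsto (fun n : ℕ => epoch C i n ω / n) atTop (𝓝 (meanCycle P C i)) := by
  have hm : Measurable fun c : CycleSpace E => (c i).2 :=
    measurable_snd.comp (measurable_pi_apply i)
  exact strong_law_ae_real (fun n ω => (C n ω i).2) (hC.integrable i)
    (fun k l hkl => (hC.indep.indepFun hkl).comp hm hm) (fun n => hC.identDistrib_length n i)

theorem ae_rightContinuous (hC : IsCycleSequence P C) (i : Fin m) : ∀ᵐ ω ∂P, ∀ n, ∀ s : ℝ≥0,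
    ContinuousWithinAt (C n ω i).1 (Set.Ici s) s :=
  ae_all_iff.2 fun n => hC.rightContinuous n i

end Basic

section Independence

variable [IsProbabilityMeasure P]

theorem isProbabilityMeasure_lengthLaw (hC : IsCycleSequence P C)
    (i : Fin m) : IsProbabilityMeasure (lengthLaw P C i) :=
  Measure.isProbabilityMeasure_map (hC.measurable_length 0 i).aemeasurable

/-- A cycle can be replaced by an independent copy of the first one in expectations that
otherwise depend on its past only. -/
theorem lintegral_past_prod (hC : IsCycleSequence P C)
    {β : Type*} [MeasurableSpace β] {n : ℕ} {X : Ω → β}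
    (hX : Measurable[past C n] X) {g : β × CycleSpace E → ℝ≥0∞} (hg : Measurable g) :
    ∫⁻ ω, g (X ω, C n ω) ∂P = ∫⁻ ω, ∫⁻ ω', g (X ω, C 0 ω') ∂P ∂P := by
  have hX' : Measurable X := hX.mono (past_le hC.measurable n) le_rfl
  have hind : IndepFun X (C n) P := by
    rw [IndepFun_iff_Indep]
    exact indep_of_indep_of_le_left (indep_past hC.measurable hC.indep n) hX.comap_le
  have hmap := hind.map_prod_eq_prod_map_map hX'.aemeasurable (hC.measurable n).aemeasurable
  rw [← lintegral_map hg (hX'.prodMk (hC.measurable n)), hmap, hC.map_eq]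
  have : IsProbabilityMeasure (P.map (C 0)) :=
    Measure.isProbabilityMeasure_map (hC.measurable 0).aemeasurable
  rw [lintegral_prod _ hg.aemeasurable, lintegral_map hg.lintegral_prod_right' hX']
  refine lintegral_congr fun ω => ?_
  exact lintegral_map (hg.comp measurable_prodMk_left) (hC.measurable 0)

/-- The indicator of `A` is carried along with `a` as part of the past variable. -/
theorem setLIntegral_past_prod (hC : IsCycleSequence P C)
    {n : ℕ} {a : Ω → ℝ} (ha : Measurable[past C n] a) {A : Set Ω}
    (hA : MeasurableSet[past C n] A) {g : ℝ × CycleSpace E → ℝ≥0∞} (hg : Measurable g) :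
    ∫⁻ ω in A, g (a ω, C n ω) ∂P = ∫⁻ ω in A, ∫⁻ ω', g (a ω, C 0 ω') ∂P ∂P := by
  have hA' := past_le hC.measurable n A hA
  have hone : Measurable[past C n] fun _ : Ω => (1 : ℝ≥0∞) := measurable_const
  have hind : Measurable[past C n] (A.indicator fun _ : Ω => (1 : ℝ≥0∞)) := hone.indicator hA
  have h := hC.lintegral_past_prod (X := fun ω => (A.indicator (fun _ : Ω => (1 : ℝ≥0∞)) ω, a ω))
    (hind.prodMk ha) (g := fun p => p.1.1 * g (p.1.2, p.2)) (by fun_prop)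
  rw [← lintegral_indicator hA', ← lintegral_indicator hA']
  refine Eq.trans (lintegral_congr fun ω => ?_) (h.trans (lintegral_congr fun ω => ?_))
  · by_cases hω : ω ∈ A <;> simp [hω]
  · by_cases hω : ω ∈ A <;> simp [hω]

theorem measurable_meanValue_rightApprox (hC : IsCycleSequence P C)
    (i : Fin m) {g : E i → ℝ≥0∞} (hg : Measurable g) (j : ℕ) :
    Measurable fun u => meanValue P C i g (rightApprox j u) := by
  have h : Measurable fun p : ℝ × Ω => cycleValue i g (rightApprox j p.1) (C 0 p.2) :=
    measurable_comp_rightApprox (g := fun u ω => cycleValue i g u (C 0 ω))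
      (fun u => (measurable_cycleValue i hg u).comp (hC.measurable 0)) j
  exact h.lintegral_prod_right'

/-- The `j` lengths after the `n`-th epoch are independent of the past and of each other, so they
add a variable with law `convPow _ j`. The induction peels off the last length, which changes `g`;
hence `g` is quantified inside. -/
theorem setLIntegral_epoch_add (hC : IsCycleSequence P C)
    (i : Fin m) {n : ℕ} {A : Set Ω} (hA : MeasurableSet[past C n] A)
    (j : ℕ) : ∀ {g : ℝ → ℝ≥0∞}, Measurable g → ∫⁻ ω in A, g (epoch C i (n + j) ω) ∂P
      = ∫⁻ ω in A, ∫⁻ s, g (epoch C i n ω + s) ∂(convPow (lengthLaw P C i) j) ∂P := by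
  have := hC.isProbabilityMeasure_lengthLaw i
  induction j with
  | zero =>
    intro g hg
    refine lintegral_congr fun ω => ?_
    rw [convPow, lintegral_dirac' _ (by fun_prop)]; simp
  | succ j ih =>
    intro g hg
    have hm : Measurable fun c : CycleSpace E => (c i).2 :=
      measurable_snd.comp (measurable_pi_apply i)
    have h1 := hC.setLIntegral_past_prod (measurable_epoch_past i (le_refl (n + j)))
      (past_mono (Nat.le_add_right n j) A hA) (g := fun p => g (p.1 + (p.2 i).2))
      (hg.comp (measurable_fst.add (hm.comp measurable_snd)))
    have h2 : ∀ x, ∫⁻ ω', g (x + (C 0 ω' i).2) ∂P = ∫⁻ y, g (x + y) ∂(lengthLaw P C i) := fun x => by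
      rw [lengthLaw, lintegral_map (by fun_prop) (hC.measurable_length 0 i)]
    simp only [h2] at h1
    have h3 : Measurable fun x => ∫⁻ y, g (x + y) ∂(lengthLaw P C i) :=
      (hg.comp measurable_add).lintegral_prod_right'
    have h4 : ∀ ω, epoch C i (n + (j + 1)) ω = epoch C i (n + j) ω + (C (n + j) ω i).2 := fun ω => by
      rw [← add_assoc, epoch, Finset.sum_range_succ, epoch]
    simp only [h4]
    rw [h1, ih h3]
    refine lintegral_congr fun ω => ?_
    rw [lintegral_convPow_succ _ (by fun_prop)]
    simp only [add_assoc]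

variable [∀ i, BorelSpace (E i)] {i : Fin m} {g : E i → ℝ≥0∞} {M : ℝ≥0∞}

theorem continuousWithinAt_meanValue (hC : IsCycleSequence P C)
    (hg : Continuous g) (hM : ∀ x, g x ≤ M) (hM' : M ≠ ∞)
    (u : ℝ) : ContinuousWithinAt (meanValue P C i g) (Set.Ici u) u := by
  refine tendsto_lintegral_filter_of_dominated_convergence (fun _ => M)
    (Eventually.of_forall fun v => ?_) (Eventually.of_forall fun v => ae_of_all _ fun ω =>
      cycleValue_le i hM v _) (by simpa using hM') ?_
  · exact (measurable_cycleValue i hg.measurable v).comp (hC.measurable 0)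
  · filter_upwards [hC.rightContinuous 0 i] with ω hω
    exact continuousWithinAt_cycleValue hg hω u

theorem measurable_meanValue (hC : IsCycleSequence P C)
    (hg : Continuous g) (hM : ∀ x, g x ≤ M) (hM' : M ≠ ∞) :
    Measurable (meanValue P C i g) := by
  refine measurable_of_tendsto_metrizable
    (hC.measurable_meanValue_rightApprox i hg.measurable) ?_
  refine tendsto_pi_nhds.2 fun u => ?_
  exact (hC.continuousWithinAt_meanValue hg hM hM' u).tendsto.comp (tendsto_rightApprox u)

/-- The substitution `setLIntegral_past_prod` needs joint measurability, so it is made at the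
rounded times; both sides then pass to the limit by right continuity and domination. -/
theorem setLIntegral_cycleValue (hC : IsCycleSequence P C)
    (hg : Continuous g) (hM : ∀ x, g x ≤ M) (hM' : M ≠ ∞) {n : ℕ}
    {a : Ω → ℝ} (ha : Measurable[past C n] a) {A : Set Ω} (hA : MeasurableSet[past C n] A) :
    ∫⁻ ω in A, cycleValue i g (a ω) (C n ω) ∂P = ∫⁻ ω in A, meanValue P C i g (a ω) ∂P := by
  have ha' : Measurable a := ha.mono (past_le hC.measurable n) le_rfl
  have hfin : ∫⁻ _ in A, M ∂P ≠ ∞ := by simp [ENNReal.mul_ne_top hM' (measure_ne_top _ _)]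
  have hψ : ∀ j, Measurable fun p : ℝ × CycleSpace E => cycleValue i g (rightApprox j p.1) p.2 :=
    measurable_comp_rightApprox (measurable_cycleValue i hg.measurable)
  have hψ' : ∀ j, Measurable fun ω => cycleValue i g (rightApprox j (a ω)) (C n ω) :=
    measurable_cycleValue_rightApprox i hg.measurable (hC.measurable n) ha'
  have hm' : ∀ j, Measurable fun ω => meanValue P C i g (rightApprox j (a ω)) := fun j =>
    (hC.measurable_meanValue_rightApprox i hg.measurable j).comp ha'
  have h1 : Tendsto (fun j => ∫⁻ ω in A, cycleValue i g (rightApprox j (a ω)) (C n ω) ∂P) atTop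
      (𝓝 (∫⁻ ω in A, cycleValue i g (a ω) (C n ω) ∂P)) := by
    refine tendsto_lintegral_of_dominated_convergence (fun _ => M) hψ'
      (fun j => ae_of_all _ fun ω => cycleValue_le i hM _ _) hfin ?_
    filter_upwards [ae_restrict_of_ae (hC.rightContinuous n i)] with ω hω
    exact (continuousWithinAt_cycleValue hg hω _).tendsto.comp (tendsto_rightApprox _)
  have h2 : Tendsto (fun j => ∫⁻ ω in A, meanValue P C i g (rightApprox j (a ω)) ∂P) atTop
      (𝓝 (∫⁻ ω in A, meanValue P C i g (a ω) ∂P)) := by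
    refine tendsto_lintegral_of_dominated_convergence (fun _ => M) hm'
      (fun j => ae_of_all _ fun ω => ?_) hfin (ae_of_all _ fun ω => ?_)
    · exact (lintegral_mono fun _ => cycleValue_le i hM _ _).trans (by simp)
    · exact (hC.continuousWithinAt_meanValue hg hM hM' _).tendsto.comp (tendsto_rightApprox _)
  refine tendsto_nhds_unique h1 (h2.congr fun j => ?_)
  exact (hC.setLIntegral_past_prod ha hA (hψ j)).symm

end Independence

end IsCycleSequence

end CycleSequence

/-! ### The process as a sum over cycles -/

section CycleCount

variable {Ω : Type*} {m : ℕ} {E : Fin m → Type*} {C : ℕ → Ω → CycleSpace E} {i : Fin m} {ω : Ω}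

theorem epoch_succ (n : ℕ) : epoch C i (n + 1) ω = epoch C i n ω + (C n ω i).2 :=
  Finset.sum_range_succ _ _

theorem monotone_epoch (hT : ∀ n, 0 ≤ (C n ω i).2) : Monotone fun n => epoch C i n ω :=
  monotone_nat_of_le_succ fun n => by rw [epoch_succ]; linarith [hT n]

theorem cycleValue_sub_epoch {g : E i → ℝ≥0∞} {t : ℝ} {k : ℕ} (h : epoch C i k ω ≤ t)
    (h' : t < epoch C i (k + 1) ω) : cycleValue i g (t - epoch C i k ω) (C k ω)
      = g ((C k ω i).1 (t - epoch C i k ω).toNNReal) := by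
  rw [epoch_succ] at h'
  exact cycleValue_of (by linarith) (by linarith)

theorem cycleValue_sub_epoch_eq_zero {g : E i → ℝ≥0∞} {t : ℝ} {k : ℕ}
    (h : ¬ (epoch C i k ω ≤ t ∧ t < epoch C i (k + 1) ω)) :
    cycleValue i g (t - epoch C i k ω) (C k ω) = 0 := by
  rw [epoch_succ] at h
  exact cycleValue_eq_zero fun h' => h ⟨by linarith [h'.1], by linarith [h'.2]⟩

theorem eq_of_epoch_le_of_lt (hT : ∀ n, 0 ≤ (C n ω i).2) {t : ℝ} {k l : ℕ}
    (hk : epoch C i k ω ≤ t) (hk' : t < epoch C i (k + 1) ω) (hl : epoch C i l ω ≤ t)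
    (hl' : t < epoch C i (l + 1) ω) : k = l := by
  have key : ∀ {a b : ℕ}, epoch C i a ω ≤ t → t < epoch C i (b + 1) ω → a ≤ b := fun ha hb => by
    by_contra! hlt
    exact absurd (hb.trans_le (monotone_epoch hT hlt)) (not_lt.2 ha)
  exact le_antisymm (key hk hl') (key hl hk')

theorem epoch_cycleCount_le (hT : ∀ n, 0 ≤ (C n ω i).2)
    (hS : Tendsto (fun n => epoch C i n ω) atTop atTop) {t : ℝ} (ht : 0 ≤ t) :
    epoch C i (cycleCount C i t ω) ω ≤ t ∧ t < epoch C i (cycleCount C i t ω + 1) ω := by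
  have hne : {n : ℕ | epoch C i n ω ≤ t}.Nonempty := ⟨0, by simpa [epoch] using ht⟩
  have hb : BddAbove {n : ℕ | epoch C i n ω ≤ t} := by
    obtain ⟨N, hN⟩ := (hS.eventually_gt_atTop t).exists
    refine ⟨N, fun n hn => ?_⟩
    by_contra! hlt
    exact absurd (hN.trans_le (monotone_epoch hT hlt.le)) (not_lt.2 hn)
  refine ⟨Nat.sSup_mem hne hb, ?_⟩
  by_contra! hle
  exact absurd (le_csSup hb (show cycleCount C i t ω + 1 ∈ {n : ℕ | epoch C i n ω ≤ t} from hle))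
    (not_le.2 (Nat.lt_succ_self _))

/-- The value of the regenerative process, as a sum over the cycles after the first `n`. -/
theorem tsum_cycleValue (hT : ∀ n, 0 ≤ (C n ω i).2)
    (hS : Tendsto (fun n => epoch C i n ω) atTop atTop) (g : E i → ℝ≥0∞) {t : ℝ} {n : ℕ}
    (hn : epoch C i n ω ≤ t) : ∑' j, cycleValue i g (t - epoch C i (n + j) ω) (C (n + j) ω)
      = g (regenerative C i t ω) := by
  have h0 : (0 : ℝ) ≤ epoch C i n ω := Finset.sum_nonneg fun k _ => hT k
  obtain ⟨h1, h2⟩ := epoch_cycleCount_le hT hS (h0.trans hn)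
  have hle : n ≤ cycleCount C i t ω := by
    by_contra! hlt
    exact absurd (h2.trans_le (monotone_epoch hT hlt)) (not_lt.2 hn)
  have he : n + (cycleCount C i t ω - n) = cycleCount C i t ω := by omega
  rw [tsum_eq_single (cycleCount C i t ω - n), he, cycleValue_sub_epoch h1 h2, regenerative]
  intro j hj
  refine cycleValue_sub_epoch_eq_zero fun h => hj ?_
  have := eq_of_epoch_le_of_lt hT h.1 h.2 h1 h2
  omega

/-- Before the `n`-th epoch the regenerative process is a function of the first `n` cycles. -/
theorem sum_cycleValue (hT : ∀ n, 0 ≤ (C n ω i).2)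
    (hS : Tendsto (fun n => epoch C i n ω) atTop atTop) (g : E i → ℝ≥0∞) {t : ℝ} (ht : 0 ≤ t)
    {n : ℕ} (hn : t < epoch C i n ω) :
    ∑ k ∈ Finset.range n, cycleValue i g (t - epoch C i k ω) (C k ω)
      = g (regenerative C i t ω) := by
  obtain ⟨h1, h2⟩ := epoch_cycleCount_le hT hS ht
  have hlt : cycleCount C i t ω < n := by
    by_contra! hle
    exact absurd (hn.trans_le (monotone_epoch hT hle)) (not_lt.2 h1)
  rw [Finset.sum_eq_single (cycleCount C i t ω), cycleValue_sub_epoch h1 h2, regenerative]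
  · intro j _ hj
    exact cycleValue_sub_epoch_eq_zero fun h => hj (eq_of_epoch_le_of_lt hT h.1 h.2 h1 h2)
  · intro h
    exact absurd (Finset.mem_range.2 hlt) h

/-- A countable supremum of measurable functions, which makes the cycle count measurable everywhere
and not only almost everywhere. -/
theorem cycleCount_eq_iSup (C : ℕ → Ω → CycleSpace E) (i : Fin m) (t : ℝ) (ω : Ω) :
    cycleCount C i t ω = ⨆ n : ℕ, {ω | epoch C i n ω ≤ t}.indicator (fun _ => n) ω := by
  classical
  set A := {n : ℕ | epoch C i n ω ≤ t} with hA
  have hf : ∀ n : ℕ, {ω | epoch C i n ω ≤ t}.indicator (fun _ => n) ω = if n ∈ A then n else 0 :=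
    fun n => by simp [Set.indicator, hA]
  simp_rw [hf]
  rw [cycleCount, ← hA]
  by_cases hb : BddAbove A
  · have hb' : BddAbove (Set.range fun n => if n ∈ A then n else 0) := by
      obtain ⟨N, hN⟩ := hb
      refine ⟨N, ?_⟩
      rintro _ ⟨n, rfl⟩
      by_cases hn : n ∈ A
      · simpa [hn] using hN hn
      · simp [hn]
    refine le_antisymm ?_ (ciSup_le fun n => ?_)
    · rcases A.eq_empty_or_nonempty with he | hne
      · simp [he]
      · refine csSup_le hne fun n hn => ?_
        have := le_ciSup hb' n
        simpa [hn] using this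
    · by_cases hn : n ∈ A
      · simpa [hn] using le_csSup hb hn
      · simp [hn]
  -- In the unbounded case both suprema in `ℕ` take the default value `0`.
  · have hb' : ¬ BddAbove (Set.range fun n => if n ∈ A then n else 0) := by
      rintro ⟨N, hN⟩
      refine hb ⟨N, fun n hn => ?_⟩
      simpa [hn] using hN ⟨n, rfl⟩
    rw [Nat.sSup_of_not_bddAbove hb, iSup, Nat.sSup_of_not_bddAbove hb']

end CycleCount

section CycleSequence

variable {Ω : Type*} {m : ℕ} {E : Fin m → Type*} [MeasurableSpace Ω] [∀ i, MetricSpace (E i)]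
  [∀ i, MeasurableSpace (E i)] {P : Measure Ω} {C : ℕ → Ω → CycleSpace E}

namespace IsCycleSequence

theorem ae_tendsto_epoch (hC : IsCycleSequence P C) (i : Fin m) :
    ∀ᵐ ω ∂P, Tendsto (fun n => epoch C i n ω) atTop atTop := by
  filter_upwards [hC.ae_tendsto_epoch_div i] with ω hω
  refine (hω.pos_mul_atTop (hC.mean_pos i) tendsto_natCast_atTop_atTop).congr' ?_
  filter_upwards [eventually_gt_atTop 0] with n hn
  have : (n : ℝ) ≠ 0 := by positivity
  field_simp

theorem measurable_cycleCount (hC : IsCycleSequence P C) (i : Fin m) (t : ℝ) :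
    Measurable (cycleCount C i t) := by
  have : cycleCount C i t
      = fun ω => ⨆ n : ℕ, {ω | epoch C i n ω ≤ t}.indicator (fun _ => n) ω :=
    funext fun ω => cycleCount_eq_iSup C i t ω
  rw [this]
  exact Measurable.iSup fun n => measurable_const.indicator
    (measurableSet_le (hC.measurable_epoch i n) measurable_const)

theorem aemeasurable_regenerative [∀ i, BorelSpace (E i)] (hC : IsCycleSequence P C) (i : Fin m)
    (t : ℝ) : AEMeasurable (regenerative C i t) P := by
  have hN := hC.measurable_cycleCount i t
  have hN' : Measurable fun ω => (cycleCount C i t ω, ω) := hN.prodMk measurable_id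
  have hZ : Measurable fun ω => C (cycleCount C i t ω) ω := by
    have h : Measurable fun p : ℕ × Ω => C p.1 p.2 :=
      measurable_from_prod_countable_right fun n => hC.measurable n
    exact h.comp hN'
  have hS : Measurable fun ω => t - epoch C i (cycleCount C i t ω) ω := by
    have h : Measurable fun p : ℕ × Ω => epoch C i p.1 p.2 :=
      measurable_from_prod_countable_right fun n => hC.measurable_epoch i n
    exact measurable_const.sub (h.comp hN')
  refine aemeasurable_of_tendsto_metrizable_ae atTop
    (fun j => (measurable_path_rightApprox i hZ hS j).aemeasurable) ?_
  filter_upwards [hC.ae_rightContinuous i] with ω hω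
  exact tendsto_path_rightApprox (hω _) _

end IsCycleSequence

end CycleSequence

/-! ### The renewal theorem for one component -/

section Limit

variable {Ω : Type*} {m : ℕ} {E : Fin m → Type*} [MeasurableSpace Ω] [∀ i, MetricSpace (E i)]
  [∀ i, MeasurableSpace (E i)] [∀ i, BorelSpace (E i)] {P : Measure Ω} [IsProbabilityMeasure P]
  {C : ℕ → Ω → CycleSpace E}

/-- The mean of `g` at time `u` of the regenerative process of component `i`, written as a
convolution with the renewal measure. -/
noncomputable def renewalMean (P : Measure Ω) (C : ℕ → Ω → CycleSpace E) (i : Fin m)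
    (g : E i → ℝ≥0∞) (u : ℝ) : ℝ≥0∞ :=
  ∫⁻ s, meanValue P C i g (u - s) ∂(renewalMeasure (lengthLaw P C i))

namespace IsCycleSequence

variable {i : Fin m} {g : E i → ℝ≥0∞} {M : ℝ≥0∞}

theorem aemeasurable_cycleValue (hC : IsCycleSequence P C) (hg : Continuous g) {a : Ω → ℝ}
    (ha : Measurable a) (n : ℕ) : AEMeasurable (fun ω => cycleValue i g (a ω) (C n ω)) P := by
  refine aemeasurable_of_tendsto_metrizable_ae atTop (fun j =>
    (measurable_cycleValue_rightApprox i hg.measurable (hC.measurable n) ha j).aemeasurable) ?_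
  filter_upwards [hC.rightContinuous n i] with ω hω
  exact (continuousWithinAt_cycleValue hg hω _).tendsto.comp (tendsto_rightApprox _)

theorem measurable_renewalMean (hC : IsCycleSequence P C) (hg : Continuous g)
    (hM : ∀ x, g x ≤ M) (hM' : M ≠ ∞) : Measurable (renewalMean P C i g) := by
  have := hC.isProbabilityMeasure_lengthLaw i
  have h : Measurable fun p : ℝ × ℝ => meanValue P C i g (p.1 - p.2) :=
    (hC.measurable_meanValue hg hM hM').comp (measurable_fst.sub measurable_snd)
  exact h.lintegral_prod_right'

/-- After the `n`-th epoch the process evolves like an independent copy started at that epoch. -/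
theorem setLIntegral_regenerative (hC : IsCycleSequence P C) (hg : Continuous g)
    (hM : ∀ x, g x ≤ M) (hM' : M ≠ ∞) {n : ℕ} {t : ℝ} {A : Set Ω}
    (hA : MeasurableSet[past C n] A) (hAt : ∀ ω ∈ A, epoch C i n ω ≤ t) :
    ∫⁻ ω in A, g (regenerative C i t ω) ∂P
      = ∫⁻ ω in A, renewalMean P C i g (t - epoch C i n ω) ∂P := by
  have := hC.isProbabilityMeasure_lengthLaw i
  have hA' := past_le hC.measurable n A hA
  have hmv := hC.measurable_meanValue hg hM hM'
  have hep := hC.measurable_epoch i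
  calc ∫⁻ ω in A, g (regenerative C i t ω) ∂P
      = ∫⁻ ω in A, ∑' j, cycleValue i g (t - epoch C i (n + j) ω) (C (n + j) ω) ∂P := by
        refine setLIntegral_congr_fun_ae hA' ?_
        filter_upwards [hC.ae_nonneg i, hC.ae_tendsto_epoch i] with ω h1 h2 hω
        exact (tsum_cycleValue h1 h2 g (hAt ω hω)).symm
    _ = ∑' j, ∫⁻ ω in A, cycleValue i g (t - epoch C i (n + j) ω) (C (n + j) ω) ∂P :=
        lintegral_tsum fun j => (hC.aemeasurable_cycleValue hg
          (measurable_const.sub (hep (n + j))) (n + j)).restrict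
    -- Cycle `n + j` is independent of the first `n + j` cycles, which determine both `A` and the
    -- epoch at which it starts.
    _ = ∑' j, ∫⁻ ω in A, meanValue P C i g (t - epoch C i (n + j) ω) ∂P := by
        refine tsum_congr fun j => ?_
        exact hC.setLIntegral_cycleValue hg hM hM'
          (measurable_const.sub (measurable_epoch_past i le_rfl))
          (past_mono (Nat.le_add_right n j) A hA)
    _ = ∑' j, ∫⁻ ω in A, ∫⁻ s, meanValue P C i g (t - (epoch C i n ω + s))
          ∂(convPow (lengthLaw P C i) j) ∂P := by
        refine tsum_congr fun j => ?_
        exact hC.setLIntegral_epoch_add i hA j (g := fun x => meanValue P C i g (t - x))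
          (hmv.comp (measurable_const.sub measurable_id))
    _ = ∫⁻ ω in A, ∑' j, ∫⁻ s, meanValue P C i g (t - (epoch C i n ω + s))
          ∂(convPow (lengthLaw P C i) j) ∂P := by
        refine (lintegral_tsum fun j => ?_).symm
        have h : Measurable fun p : Ω × ℝ => meanValue P C i g (t - (epoch C i n p.1 + p.2)) :=
          hmv.comp (measurable_const.sub (((hep n).comp measurable_fst).add measurable_snd))
        exact h.lintegral_prod_right'.aemeasurable
    _ = ∫⁻ ω in A, renewalMean P C i g (t - epoch C i n ω) ∂P := by
        refine lintegral_congr fun ω => ?_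
        rw [renewalMean, lintegral_renewalMeasure]
        simp only [sub_sub]

theorem meanValue_const (hC : IsCycleSequence P C) (i : Fin m) (c : ℝ≥0∞) (u : ℝ) :
    meanValue P C i (fun _ => c) u = c * tail (lengthLaw P C i) u := by
  have h : ∀ ω, cycleValue i (fun _ => c) u (C 0 ω)
      = {ω | 0 ≤ u ∧ u < (C 0 ω i).2}.indicator (fun _ => c) ω := fun ω => rfl
  have hm : MeasurableSet {ω | 0 ≤ u ∧ u < (C 0 ω i).2} :=
    (MeasurableSet.const _).inter (measurableSet_lt measurable_const (hC.measurable_length 0 i))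
  rw [meanValue]
  simp_rw [h]
  rw [lintegral_indicator_const hm]
  congr 1
  by_cases hu : 0 ≤ u
  · rw [tail, Set.indicator_of_mem (Set.mem_Ici.2 hu), lengthLaw,
      Measure.map_apply (hC.measurable_length 0 i) measurableSet_Ioi]
    congr 1
    ext ω
    simp [hu]
  · simp [tail, hu]

theorem meanValue_le (hC : IsCycleSequence P C) (hM : ∀ x, g x ≤ M) (u : ℝ) :
    meanValue P C i g u ≤ M * tail (lengthLaw P C i) u := by
  rw [← hC.meanValue_const]
  exact lintegral_mono fun ω => Set.indicator_le_indicator (hM _)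

theorem meanValue_le_const (hM : ∀ x, g x ≤ M) (u : ℝ) : meanValue P C i g u ≤ M :=
  (lintegral_mono fun _ => cycleValue_le i hM u _).trans (by simp)

/-- Some cycle is always in progress, so the identity is exact at every `u ≥ 0`. It converts a lower
bound for `b - f` into an upper bound for `f`. -/
theorem renewalMean_const (hC : IsCycleSequence P C) (i : Fin m) (c : ℝ≥0∞) {u : ℝ}
    (hu : 0 ≤ u) : renewalMean P C i (fun _ => c) u = c := by
  have := hC.isProbabilityMeasure_lengthLaw i
  rw [renewalMean]
  simp_rw [hC.meanValue_const]
  rw [lintegral_const_mul (f := fun s => tail (lengthLaw P C i) (u - s)) _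
      (measurable_tail.comp (measurable_const.sub measurable_id)),
    lintegral_tail_renewalMeasure (hC.lengthLaw_Iio i) (hC.lengthLaw_Ioi i)]
  simp [hu]

theorem meanValue_add (hC : IsCycleSequence P C) (hg : Measurable g) (g' : E i → ℝ≥0∞) (u : ℝ) :
    meanValue P C i (fun x => g x + g' x) u = meanValue P C i g u + meanValue P C i g' u := by
  rw [meanValue, meanValue, meanValue,
    ← lintegral_add_left (f := fun ω => cycleValue i g u (C 0 ω))
      ((measurable_cycleValue i hg u).comp (hC.measurable 0))]
  refine lintegral_congr fun ω => ?_
  exact congrFun (Set.indicator_add _ _ _) u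

theorem renewalMean_add (hC : IsCycleSequence P C) (hg : Continuous g) (hM : ∀ x, g x ≤ M)
    (hM' : M ≠ ∞) (g' : E i → ℝ≥0∞) (u : ℝ) :
    renewalMean P C i (fun x => g x + g' x) u
      = renewalMean P C i g u + renewalMean P C i g' u := by
  rw [renewalMean, renewalMean, renewalMean, ← lintegral_add_left
    (f := fun s => meanValue P C i g (u - s)) ((hC.measurable_meanValue hg hM hM').comp (measurable_const.sub measurable_id))]
  exact lintegral_congr fun s => hC.meanValue_add hg.measurable g' _

theorem renewalMean_le (hC : IsCycleSequence P C) (hM : ∀ x, g x ≤ M) (u : ℝ) :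
    renewalMean P C i g u ≤ M := by
  have := hC.isProbabilityMeasure_lengthLaw i
  calc renewalMean P C i g u
      ≤ ∫⁻ s, M * tail (lengthLaw P C i) (u - s) ∂(renewalMeasure (lengthLaw P C i)) :=
        lintegral_mono fun s => hC.meanValue_le hM _
    _ = M * (Set.Ici (0 : ℝ)).indicator 1 u := by
        rw [lintegral_const_mul (f := fun s => tail (lengthLaw P C i) (u - s)) _
      (measurable_tail.comp (measurable_const.sub measurable_id)),
          lintegral_tail_renewalMeasure (hC.lengthLaw_Iio i) (hC.lengthLaw_Ioi i)]
    _ ≤ M := by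
        refine (mul_le_mul_right (Set.indicator_apply_le' (fun _ => le_rfl)
          fun _ => zero_le) M).trans_eq (mul_one M)

theorem lintegral_meanValue_ne_top (hC : IsCycleSequence P C) (hM : ∀ x, g x ≤ M) (hM' : M ≠ ∞) :
    ∫⁻ u, meanValue P C i g u ≠ ∞ := by
  refine ((lintegral_mono fun u => hC.meanValue_le hM u).trans_lt ?_).ne
  rw [lintegral_const_mul _ measurable_tail, hC.lintegral_tail]
  exact ENNReal.mul_lt_top hM'.lt_top ENNReal.ofReal_lt_top

theorem eventually_le_renewalMean (hC : IsCycleSequence P C) (hg : Continuous g)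
    (hM : ∀ x, g x ≤ M) (hM' : M ≠ ∞) {c : ℝ}
    (hc : c < (∫⁻ u, meanValue P C i g u).toReal / meanCycle P C i) :
    ∀ᶠ u in atTop, ENNReal.ofReal c ≤ renewalMean P C i g u := by
  have := hC.isProbabilityMeasure_lengthLaw i
  have hm := hC.measurable_meanValue hg hM hM'
  have htop : ∀ u, meanValue P C i g u ≠ ∞ := fun u =>
    ((meanValue_le_const hM u).trans_lt hM'.lt_top).ne
  rw [← integral_toReal hm.aemeasurable (ae_of_all _ fun u => (htop u).lt_top)] at hc
  have h := eventually_le_lintegral_renewalMeasure (hC.lengthLaw_Iio i) (hC.lengthLaw_Ioi i)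
    (hC.nonarithmetic i) (hC.mean_pos i) (hC.lintegral_tail i)
    (h := fun u => (meanValue P C i g u).toReal) (fun _ => ENNReal.toReal_nonneg)
    (integrable_toReal_of_lintegral_ne_top hm.aemeasurable
      (hC.lintegral_meanValue_ne_top hM hM'))
    (fun u => (ENNReal.continuousAt_toReal (htop u)).comp_continuousWithinAt
      (hC.continuousWithinAt_meanValue hg hM hM' u)) hc
  filter_upwards [h] with u hu
  refine hu.trans_eq (lintegral_congr fun s => ENNReal.ofReal_toReal (htop _))

theorem lintegral_meanValue_add (hC : IsCycleSequence P C) (hg : Continuous g)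
    (hM : ∀ x, g x ≤ M) (hM' : M ≠ ∞) (g' : E i → ℝ≥0∞) :
    ∫⁻ u, meanValue P C i (fun x => g x + g' x) u
      = (∫⁻ u, meanValue P C i g u) + ∫⁻ u, meanValue P C i g' u := by
  rw [← lintegral_add_left (hC.measurable_meanValue hg hM hM')]
  exact lintegral_congr fun u => hC.meanValue_add hg.measurable g' u

/-- The renewal theorem for one regenerative process. -/
theorem tendsto_renewalMean (hC : IsCycleSequence P C) {f : E i → ℝ} (hf : Continuous f) {b : ℝ}
    (hf0 : ∀ x, 0 ≤ f x) (hfb : ∀ x, f x ≤ b) :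
    Tendsto (fun u => (renewalMean P C i (fun x => ENNReal.ofReal (f x)) u).toReal) atTop
      (𝓝 ((∫⁻ u, meanValue P C i (fun x => ENNReal.ofReal (f x)) u).toReal
        / meanCycle P C i)) := by
  have hμ := hC.mean_pos i
  set g : E i → ℝ≥0∞ := fun x => ENNReal.ofReal (f x) with hg
  -- The complement of `g`: the two renewal means and the two candidate limits have the same sum
  -- `b`, so lower bounds for both give two-sided convergence.
  set g' : E i → ℝ≥0∞ := fun x => ENNReal.ofReal (b - f x) with hg'
  have hgc : Continuous g := ENNReal.continuous_ofReal.comp hf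
  have hgc' : Continuous g' := ENNReal.continuous_ofReal.comp (continuous_const.sub hf)
  have hgb : ∀ x, g x ≤ ENNReal.ofReal b := fun x => ENNReal.ofReal_le_ofReal (hfb x)
  have hgb' : ∀ x, g' x ≤ ENNReal.ofReal b := fun x =>
    ENNReal.ofReal_le_ofReal (by linarith [hf0 x])
  have htop : ENNReal.ofReal b ≠ ∞ := ENNReal.ofReal_ne_top
  have hsum : (fun x => g x + g' x) = fun _ => ENNReal.ofReal b := funext fun x => by
    simp only [hg, hg']
    rw [← ENNReal.ofReal_add (hf0 x) (by linarith [hfb x])]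
    congr 1; ring
  have hfin : ∀ u, renewalMean P C i g u ≠ ∞ := fun u =>
    ((hC.renewalMean_le hgb u).trans_lt htop.lt_top).ne
  have hfin' : ∀ u, renewalMean P C i g' u ≠ ∞ := fun u =>
    ((hC.renewalMean_le hgb' u).trans_lt htop.lt_top).ne
  have h1 : ∀ u, 0 ≤ u →
      (renewalMean P C i g u).toReal + (renewalMean P C i g' u).toReal
        = (ENNReal.ofReal b).toReal := fun u hu => by
    rw [← ENNReal.toReal_add (hfin u) (hfin' u), ← hC.renewalMean_add hgc hgb htop, hsum,
      hC.renewalMean_const i _ hu]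
  have h2 : (∫⁻ u, meanValue P C i g u).toReal / meanCycle P C i
      + (∫⁻ u, meanValue P C i g' u).toReal / meanCycle P C i = (ENNReal.ofReal b).toReal := by
    rw [← add_div, ← ENNReal.toReal_add (hC.lintegral_meanValue_ne_top hgb htop)
      (hC.lintegral_meanValue_ne_top hgb' htop), ← hC.lintegral_meanValue_add hgc hgb htop, hsum]
    simp_rw [hC.meanValue_const]
    rw [lintegral_const_mul _ measurable_tail, hC.lintegral_tail, ENNReal.toReal_mul,
      ENNReal.toReal_ofReal hμ.le, mul_div_assoc, div_self hμ.ne', mul_one]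
  set c := (∫⁻ u, meanValue P C i g u).toReal / meanCycle P C i with hc
  rw [Metric.tendsto_nhds]
  intro ε hε
  have e1 := hC.eventually_le_renewalMean hgc hgb htop (show c - ε / 2 < c by linarith)
  have e2 := hC.eventually_le_renewalMean hgc' hgb' htop (sub_lt_self _ (half_pos hε))
  filter_upwards [e1, e2, eventually_ge_atTop 0] with u h3 h4 hu
  rw [ENNReal.ofReal_le_iff_le_toReal (hfin u)] at h3
  rw [ENNReal.ofReal_le_iff_le_toReal (hfin' u)] at h4
  have h5 := h1 u hu
  rw [Real.dist_eq, abs_lt]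
  constructor <;> linarith

end IsCycleSequence

end Limit

theorem lintegral_cycleValue {m : ℕ} {E : Fin m → Type*} {i : Fin m} (g : E i → ℝ≥0∞)
    (c : CycleSpace E) : ∫⁻ s, cycleValue i g s c
      = ∫⁻ s in Set.Ico (0 : ℝ) (c i).2, g ((c i).1 s.toNNReal) :=
  lintegral_indicator measurableSet_Ico _

/-! ### The limiting law -/

section Average

variable {Ω : Type*} {m : ℕ} {E : Fin m → Type*} [MeasurableSpace Ω]
  [∀ i, MeasurableSpace (E i)] {P : Measure Ω} {C : ℕ → Ω → CycleSpace E}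

/-- The law with `∫ g dν = (E T)⁻¹ E ∫_0^T g(X(s)) ds`. -/
noncomputable def cycleAverage (P : Measure Ω) (C : ℕ → Ω → CycleSpace E) (i : Fin m) :
    Measure (E i) :=
  (ENNReal.ofReal (meanCycle P C i))⁻¹ •
    ((P.prod volume).restrict {p : Ω × ℝ | 0 ≤ p.2 ∧ p.2 < (C 0 p.1 i).2}).map
      fun p => (C 0 p.1 i).1 p.2.toNNReal

namespace IsCycleSequence

variable [∀ i, MetricSpace (E i)] [∀ i, BorelSpace (E i)]

/-- Needed for `cycleAverage` to be meaningful: `Measure.map` is zero by default for a map that is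
not almost everywhere measurable. -/
theorem aemeasurable_path_prod [SFinite P] (hC : IsCycleSequence P C) (i : Fin m) :
    AEMeasurable (fun p : Ω × ℝ => (C 0 p.1 i).1 p.2.toNNReal) (P.prod volume) := by
  have hZ : Measurable fun p : Ω × ℝ => C 0 p.1 := (hC.measurable 0).comp measurable_fst
  refine aemeasurable_of_tendsto_metrizable_ae atTop
    (fun j => (measurable_path_rightApprox i hZ measurable_snd j).aemeasurable) ?_
  filter_upwards [Measure.quasiMeasurePreserving_fst.ae (hC.rightContinuous 0 i)] with p hp
  exact tendsto_path_rightApprox hp _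

theorem measurableSet_cycle (hC : IsCycleSequence P C) (i : Fin m) :
    MeasurableSet {p : Ω × ℝ | 0 ≤ p.2 ∧ p.2 < (C 0 p.1 i).2} :=
  (measurableSet_le measurable_const measurable_snd).inter
    (measurableSet_lt measurable_snd ((hC.measurable_length 0 i).comp measurable_fst))

theorem aemeasurable_cycleValue_prod [SFinite P] (hC : IsCycleSequence P C) {i : Fin m}
    {g : E i → ℝ≥0∞} (hg : Measurable g) :
    AEMeasurable (fun p : Ω × ℝ => cycleValue i g p.2 (C 0 p.1)) (P.prod volume) :=
  (hg.comp_aemeasurable (hC.aemeasurable_path_prod i)).indicator (hC.measurableSet_cycle i)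

theorem isCycleAverage [SFinite P] (hC : IsCycleSequence P C) (i : Fin m) :
    IsCycleAverage P C i (cycleAverage P C i) := by
  intro g hg
  rw [cycleAverage, lintegral_smul_measure, smul_eq_mul,
    lintegral_map' hg.aemeasurable (hC.aemeasurable_path_prod i).restrict,
    ← lintegral_indicator (hC.measurableSet_cycle i)]
  congr 1
  refine (lintegral_prod _ (hC.aemeasurable_cycleValue_prod hg)).trans ?_
  refine lintegral_congr fun ω => ?_
  exact lintegral_cycleValue g (C 0 ω)

theorem isProbabilityMeasure_cycleAverage [SFinite P] (hC : IsCycleSequence P C) (i : Fin m) :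
    IsProbabilityMeasure (cycleAverage P C i) := by
  constructor
  have h := hC.isCycleAverage i 1 measurable_one
  simp only [Pi.one_apply, lintegral_one, Measure.restrict_apply_univ, Real.volume_Ico,
    sub_zero] at h
  rw [h, ← ofReal_integral_eq_lintegral_ofReal (hC.integrable i) (hC.nonneg i), ← meanCycle]
  exact ENNReal.inv_mul_cancel (by simpa using hC.mean_pos i) ENNReal.ofReal_ne_top

theorem lintegral_meanValue [SFinite P] (hC : IsCycleSequence P C) {i : Fin m} {g : E i → ℝ≥0∞}
    (hg : Measurable g) : ∫⁻ u, meanValue P C i g u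
      = ∫⁻ ω, (∫⁻ s in Set.Ico (0 : ℝ) (C 0 ω i).2, g ((C 0 ω i).1 s.toNNReal)) ∂P := by
  refine (lintegral_lintegral_swap (μ := P) (ν := volume)
    (f := fun ω u => cycleValue i g u (C 0 ω)) (hC.aemeasurable_cycleValue_prod hg)).symm.trans ?_
  refine lintegral_congr fun ω => ?_
  exact lintegral_cycleValue g (C 0 ω)

theorem integral_cycleAverage [SFinite P] (hC : IsCycleSequence P C) {i : Fin m} {f : E i → ℝ}
    (hf : Continuous f) (hf0 : ∀ x, 0 ≤ f x) : ∫ x, f x ∂(cycleAverage P C i)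
      = (∫⁻ u, meanValue P C i (fun x => ENNReal.ofReal (f x)) u).toReal / meanCycle P C i := by
  have hg : Measurable fun x => ENNReal.ofReal (f x) := hf.measurable.ennreal_ofReal
  rw [integral_eq_lintegral_of_nonneg_ae (ae_of_all _ hf0) hf.measurable.aestronglyMeasurable,
    hC.isCycleAverage i _ hg, ← hC.lintegral_meanValue hg, ENNReal.toReal_mul, ENNReal.toReal_inv,
    ENNReal.toReal_ofReal (hC.mean_pos i).le, div_eq_inv_mul]

end IsCycleSequence

end Average

/-! ### Conditioning on the first cycles -/

section OneComponent

variable {Ω : Type*} {m : ℕ} {E : Fin m → Type*} [MeasurableSpace Ω] [∀ i, MetricSpace (E i)]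
  [∀ i, MeasurableSpace (E i)] [∀ i, BorelSpace (E i)] {P : Measure Ω} [IsProbabilityMeasure P]
  {C : ℕ → Ω → CycleSpace E}

namespace IsCycleSequence

variable {i : Fin m}

theorem aestronglyMeasurable_comp_regenerative (hC : IsCycleSequence P C) {f : E i → ℝ}
    (hf : Continuous f) (t : ℝ) :
    AEStronglyMeasurable (fun ω => f (regenerative C i t ω)) P :=
  (hf.measurable.comp_aemeasurable (hC.aemeasurable_regenerative i t)).aestronglyMeasurable

/-- Conditionally on the first `n` cycles, a function of the process at time `t` that is
restricted to `S_n ≤ t` has the mean that the renewal convolution gives. -/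
theorem condExp_regenerative (hC : IsCycleSequence P C) {f : E i → ℝ} (hf : Continuous f) {b : ℝ}
    (hf0 : ∀ x, 0 ≤ f x) (hfb : ∀ x, f x ≤ b) (n : ℕ) (t : ℝ) :
    {ω | epoch C i n ω ≤ t}.indicator (fun ω =>
        (renewalMean P C i (fun x => ENNReal.ofReal (f x)) (t - epoch C i n ω)).toReal)
      =ᵐ[P] P[{ω | epoch C i n ω ≤ t}.indicator (fun ω => f (regenerative C i t ω)) | past C n] := by
  have hle := past_le hC.measurable n
  have hg : Continuous fun x => ENNReal.ofReal (f x) := ENNReal.continuous_ofReal.comp hf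
  have hgb : ∀ x, ENNReal.ofReal (f x) ≤ ENNReal.ofReal b := fun x =>
    ENNReal.ofReal_le_ofReal (hfb x)
  have hm := hC.measurable_renewalMean hg hgb ENNReal.ofReal_ne_top
  have hD : MeasurableSet[past C n] {ω | epoch C i n ω ≤ t} :=
    measurable_epoch_past i le_rfl measurableSet_Iic
  have hDm : Measurable[past C n] fun ω =>
      (renewalMean P C i (fun x => ENNReal.ofReal (f x)) (t - epoch C i n ω)).toReal :=
    hm.ennreal_toReal.comp (Measurable.const_sub (measurable_epoch_past i le_rfl) t)
  have hbound : ∀ u, renewalMean P C i (fun x => ENNReal.ofReal (f x)) u < ∞ := fun u =>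
    (hC.renewalMean_le hgb u).trans_lt ENNReal.ofReal_lt_top
  have hGm : Measurable fun ω =>
      renewalMean P C i (fun x => ENNReal.ofReal (f x)) (t - epoch C i n ω) :=
    hm.comp (measurable_const.sub (hC.measurable_epoch i n))
  have hYi : Integrable (fun ω => f (regenerative C i t ω)) P :=
    Integrable.of_bound (hC.aestronglyMeasurable_comp_regenerative hf t) b
      (ae_of_all _ fun ω => by rw [Real.norm_of_nonneg (hf0 _)]; exact hfb _)
  have hVi : Integrable (fun ω =>
      (renewalMean P C i (fun x => ENNReal.ofReal (f x)) (t - epoch C i n ω)).toReal) P :=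
    Integrable.of_bound (hDm.mono hle le_rfl).aestronglyMeasurable (ENNReal.ofReal b).toReal
      (ae_of_all _ fun ω => by
        rw [Real.norm_of_nonneg ENNReal.toReal_nonneg]
        exact ENNReal.toReal_mono ENNReal.ofReal_ne_top (hC.renewalMean_le hgb _))
  refine ae_eq_condExp_of_forall_setIntegral_eq hle (hYi.indicator (hle _ hD))
    (fun A _ _ => (hVi.indicator (hle _ hD)).integrableOn) (fun A hA _ => ?_)
    (hDm.indicator hD).stronglyMeasurable.aestronglyMeasurable
  rw [setIntegral_indicator (hle _ hD), setIntegral_indicator (hle _ hD),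
    integral_toReal hGm.aemeasurable (ae_of_all _ fun ω => hbound _),
    integral_eq_lintegral_of_nonneg_ae (ae_of_all _ fun ω => hf0 _)
      (hC.aestronglyMeasurable_comp_regenerative hf t).restrict]
  congr 1
  exact (hC.setLIntegral_regenerative hg hgb ENNReal.ofReal_ne_top
    (MeasurableSet.inter hA hD) fun ω hω => hω.2).symm

end IsCycleSequence

end OneComponent

/-! ### Separation of components by the law of large numbers -/

theorem tendsto_comp_floor_div {s : ℕ → ℝ} {μ l : ℝ} (hl : 0 < l)
    (hs : Tendsto (fun n : ℕ => s n / n) atTop (𝓝 μ)) :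
    Tendsto (fun t : ℝ => s ⌊t / l⌋₊ / t) atTop (𝓝 (μ / l)) := by
  have hfl : Tendsto (fun t : ℝ => ⌊t / l⌋₊) atTop atTop :=
    tendsto_nat_floor_atTop.comp (tendsto_id.atTop_div_const hl)
  have h1 : Tendsto (fun t : ℝ => (⌊l⁻¹ * t⌋₊ : ℝ) / t) atTop (𝓝 l⁻¹) :=
    tendsto_nat_floor_mul_div_atTop (inv_nonneg.2 hl.le)
  refine ((hs.comp hfl).mul h1).congr' ?_
  filter_upwards [hfl.eventually_gt_atTop 0] with t ht
  have : ((⌊t / l⌋₊ : ℕ) : ℝ) ≠ 0 := by positivity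
  rw [Function.comp_apply, inv_mul_eq_div]
  field_simp

/-- The epoch number `⌊t / l⌋` occurs near time `(μ / l) t`. For `μ < l` it is left behind at linear
rate; for `μ > l`, treated next, it is still ahead. Either way the shift `β` is negligible. -/
theorem tendsto_sub_comp_floor_atTop {s : ℕ → ℝ} {μ l : ℝ} (hl : 0 < l) (hμ : μ < l) (β : ℝ)
    (hs : Tendsto (fun n : ℕ => s n / n) atTop (𝓝 μ)) :
    Tendsto (fun t : ℝ => t + β - s ⌊t / l⌋₊) atTop atTop := by
  have h1 : Tendsto (fun t : ℝ => 1 - s ⌊t / l⌋₊ / t) atTop (𝓝 (1 - μ / l)) :=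
    tendsto_const_nhds.sub (tendsto_comp_floor_div hl hs)
  have h2 : 0 < 1 - μ / l := by rw [sub_pos, div_lt_one hl]; exact hμ
  refine (tendsto_atTop_add_const_right _ β (h1.pos_mul_atTop h2 tendsto_id)).congr' ?_
  filter_upwards [eventually_gt_atTop 0] with t ht
  have : t ≠ 0 := ht.ne'
  simp only [id]
  field_simp
  ring

theorem eventually_lt_comp_floor {s : ℕ → ℝ} {μ l : ℝ} (hl : 0 < l) (hμ : l < μ) (β : ℝ)
    (hs : Tendsto (fun n : ℕ => s n / n) atTop (𝓝 μ)) :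
    ∀ᶠ t : ℝ in atTop, t + β < s ⌊t / l⌋₊ := by
  have h1 : Tendsto (fun t : ℝ => s ⌊t / l⌋₊ / t - 1) atTop (𝓝 (μ / l - 1)) :=
    (tendsto_comp_floor_div hl hs).sub_const 1
  have h2 : 0 < μ / l - 1 := by rw [sub_pos, one_lt_div hl]; exact hμ
  filter_upwards [(h1.pos_mul_atTop h2 tendsto_id).eventually_gt_atTop β, eventually_gt_atTop 0]
    with t h3 ht
  simp only [id] at h3
  rw [sub_mul, div_mul_cancel₀ _ ht.ne', one_mul] at h3
  linarith

section Components

variable {Ω : Type*} {m : ℕ} {E : Fin m → Type*} [MeasurableSpace Ω] [∀ i, MetricSpace (E i)]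
  [∀ i, MeasurableSpace (E i)] [∀ i, BorelSpace (E i)] {P : Measure Ω} [IsProbabilityMeasure P]
  {C : ℕ → Ω → CycleSpace E}

namespace IsCycleSequence

variable {i : Fin m}

/-- On `S_n ≤ t` the value of the process can be replaced by its conditional mean given the past,
because `Φ` depends on the past only. What remains is the distance of that mean from `c` and a term
bounded by `b` on the complement. -/
theorem abs_integral_mul_regenerative_sub_le (hC : IsCycleSequence P C) {f : E i → ℝ}
    (hf : Continuous f) {b : ℝ} (hf0 : ∀ x, 0 ≤ f x) (hfb : ∀ x, f x ≤ b) (c : ℝ) {B : ℝ}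
    (n : ℕ) (t : ℝ) {Φ : Ω → ℝ} (hΦ : AEStronglyMeasurable[past C n] Φ P) (hB0 : 0 ≤ B)
    (hB : ∀ᵐ ω ∂P, |Φ ω| ≤ B) :
    |∫ ω, Φ ω * f (regenerative C i t ω) ∂P - c * ∫ ω, Φ ω ∂P|
      ≤ B * ∫ ω, ({ω | ¬ epoch C i n ω ≤ t}.indicator (fun _ => b) ω
        + |{ω | epoch C i n ω ≤ t}.indicator (fun ω =>
          (renewalMean P C i (fun x => ENNReal.ofReal (f x)) (t - epoch C i n ω)).toReal) ω - c|)
            ∂P := by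
  have hle := past_le hC.measurable n
  have hb : ∀ x, ‖f x‖ ≤ b := fun x => by rw [Real.norm_of_nonneg (hf0 _)]; exact hfb _
  have hD : MeasurableSet {ω | epoch C i n ω ≤ t} :=
    hC.measurable_epoch i n measurableSet_Iic
  have hDc : MeasurableSet {ω | ¬ epoch C i n ω ≤ t} := hD.compl
  set Y : Ω → ℝ := fun ω => f (regenerative C i t ω) with hY
  set Y₁ : Ω → ℝ := {ω | epoch C i n ω ≤ t}.indicator Y with hY₁
  set V : Ω → ℝ := {ω | epoch C i n ω ≤ t}.indicator (fun ω =>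
      (renewalMean P C i (fun x => ENNReal.ofReal (f x)) (t - epoch C i n ω)).toReal) with hV
  have hYi : Integrable Y P :=
    Integrable.of_bound (hC.aestronglyMeasurable_comp_regenerative hf t) b
      (ae_of_all _ fun ω => hb _)
  have hYi₁ : Integrable Y₁ P := hYi.indicator hD
  have hce : V =ᵐ[P] P[Y₁ | past C n] := hC.condExp_regenerative hf hf0 hfb n t
  have hVi : Integrable V P := integrable_condExp.congr hce.symm
  have hΦ' : AEStronglyMeasurable Φ P := hΦ.mono hle
  have hΦi : Integrable Φ P := Integrable.of_bound hΦ' B hB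
  have hmul : ∀ {Z : Ω → ℝ}, Integrable Z P → Integrable (fun ω => Φ ω * Z ω) P := fun hZ =>
    hZ.bdd_mul hΦ' hB
  have hkey : ∫ ω, Φ ω * Y₁ ω ∂P = ∫ ω, Φ ω * V ω ∂P := by
    have h1 := condExp_mul_of_aestronglyMeasurable_left hΦ (hmul hYi₁) hYi₁
    have h2 : ∫ ω, (P[Φ * Y₁ | past C n]) ω ∂P = ∫ ω, (Φ * Y₁) ω ∂P := integral_condExp hle
    refine h2.symm.trans (integral_congr_ae ?_)
    filter_upwards [h1, hce] with ω h3 h4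
    rw [h3, Pi.mul_apply, h4]
  have hsplit : ∫ ω, Φ ω * Y ω ∂P - c * ∫ ω, Φ ω ∂P
      = ∫ ω, (Φ ω * (Y ω - Y₁ ω) + Φ ω * (V ω - c)) ∂P := by
    rw [integral_add (f := fun ω => Φ ω * (Y ω - Y₁ ω)) (g := fun ω => Φ ω * (V ω - c))
      (hmul (hYi.sub hYi₁)) (hmul (hVi.sub (integrable_const c)))]
    simp_rw [mul_sub]
    rw [integral_sub (hmul hYi) (hmul hYi₁), integral_sub (hmul hVi) (hΦi.mul_const c), hkey,
      integral_mul_const]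
    ring
  rw [hsplit, ← integral_const_mul, ← Real.norm_eq_abs]
  have hbi : Integrable (fun ω => B * ({ω | ¬ epoch C i n ω ≤ t}.indicator (fun _ => b) ω
      + |V ω - c|)) P :=
    Integrable.const_mul (((integrable_const b).indicator hDc).add
      (hVi.sub (integrable_const c)).abs) B
  refine norm_integral_le_of_norm_le hbi ?_
  filter_upwards [hB] with ω hω
  rw [← mul_add, norm_mul]
  refine mul_le_mul hω ?_ (norm_nonneg _) hB0
  refine (norm_add_le _ _).trans (add_le_add ?_ le_rfl)
  by_cases h : epoch C i n ω ≤ t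
  · simp [hY₁, h]
  · simp only [hY₁, Set.mem_ofPred_eq, h, not_false_eq_true, Set.indicator_of_notMem,
      Set.indicator_of_mem, sub_zero]
    exact hb _

/-- A regenerative process is asymptotically independent of the cycles up to an epoch that is
left far behind. -/
theorem tendsto_integral_mul_regenerative_sub_of_nonneg (hC : IsCycleSequence P C) {f : E i → ℝ}
    (hf : Continuous f) {b : ℝ} (hf0 : ∀ x, 0 ≤ f x) (hfb : ∀ x, f x ≤ b) {B : ℝ}
    (n : ℝ → ℕ) (τ : ℝ → ℝ) (hτ : ∀ᵐ ω ∂P, Tendsto (fun t => τ t - epoch C i (n t) ω) atTop atTop)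
    {Φ : ℝ → Ω → ℝ} (hΦ : ∀ᶠ t in atTop, AEStronglyMeasurable[past C (n t)] (Φ t) P)
    (hB : ∀ t ω, |Φ t ω| ≤ B) :
    Tendsto (fun t => ∫ ω, Φ t ω * f (regenerative C i (τ t) ω) ∂P
      - (∫ x, f x ∂(cycleAverage P C i)) * ∫ ω, Φ t ω ∂P) atTop (𝓝 0) := by
  have hΩ : Nonempty Ω := nonempty_of_isProbabilityMeasure P
  have hB0 : 0 ≤ B := (abs_nonneg _).trans (hB 0 hΩ.some)
  have hgb : ∀ x, ENNReal.ofReal (f x) ≤ ENNReal.ofReal b := fun x =>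
    ENNReal.ofReal_le_ofReal (hfb x)
  have hg : Continuous fun x => ENNReal.ofReal (f x) := ENNReal.continuous_ofReal.comp hf
  have hm := hC.measurable_renewalMean hg hgb ENNReal.ofReal_ne_top
  have hlim := hC.tendsto_renewalMean hf hf0 hfb
  rw [← hC.integral_cycleAverage hf hf0] at hlim
  set c := ∫ x, f x ∂(cycleAverage P C i) with hc
  set G : ℝ → ℝ := fun u =>
    (renewalMean P C i (fun x => ENNReal.ofReal (f x)) u).toReal with hG
  have hGb : ∀ u, |G u| ≤ |b| := fun u => by
    rw [abs_of_nonneg ENNReal.toReal_nonneg]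
    refine ENNReal.toReal_le_of_le_ofReal (abs_nonneg b) ?_
    exact (hC.renewalMean_le hgb u).trans (ENNReal.ofReal_le_ofReal (le_abs_self b))
  have hGm : Measurable G := hm.ennreal_toReal
  -- Almost surely the elapsed time tends to infinity, so the first indicator is eventually zero and
  -- the conditional mean tends to `c`; boundedness does the rest.
  have hbnd : Tendsto (fun t => B * ∫ ω, ({ω | ¬ epoch C i (n t) ω ≤ τ t}.indicator (fun _ => b) ω
        + |{ω | epoch C i (n t) ω ≤ τ t}.indicator (fun ω => G (τ t - epoch C i (n t) ω)) ω - c|)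
          ∂P) atTop (𝓝 (B * ∫ _, (0 : ℝ) ∂P)) := by
    refine Tendsto.const_mul B ?_
    refine tendsto_integral_filter_of_dominated_convergence (fun _ => |b| + (|b| + |c|))
      (Eventually.of_forall fun t => ?_) (Eventually.of_forall fun t => ae_of_all _ fun ω => ?_)
      (integrable_const _) ?_
    · have hD : MeasurableSet {ω | epoch C i (n t) ω ≤ τ t} :=
        hC.measurable_epoch i (n t) measurableSet_Iic
      have h1 : Measurable fun ω => G (τ t - epoch C i (n t) ω) :=
        hGm.comp (measurable_const.sub (hC.measurable_epoch i (n t)))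
      have h2 : Measurable fun ω =>
          |{ω | epoch C i (n t) ω ≤ τ t}.indicator (fun ω => G (τ t - epoch C i (n t) ω)) ω - c| :=
        ((h1.indicator hD).sub_const c).abs
      exact ((measurable_const.indicator hD.compl).add h2).aestronglyMeasurable
    · refine (norm_add_le _ _).trans (add_le_add ?_ ?_)
      · exact (norm_indicator_le_norm_self _ _)
      · rw [norm_abs_eq_norm]
        refine (norm_sub_le _ _).trans (add_le_add ?_ le_rfl)
        exact (norm_indicator_le_norm_self _ _).trans (hGb _)
    · filter_upwards [hτ] with ω hω
      have h1 : Tendsto (fun t => |G (τ t - epoch C i (n t) ω) - c|) atTop (𝓝 0) := by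
        have := ((hlim.comp hω).sub_const c).abs
        simpa using this
      refine h1.congr' ?_
      filter_upwards [hω.eventually_ge_atTop 0] with t ht
      have h2 : epoch C i (n t) ω ≤ τ t := by linarith
      simp [h2]
  rw [integral_zero, mul_zero] at hbnd
  refine squeeze_zero_norm' ?_ hbnd
  filter_upwards [hΦ] with t ht
  exact hC.abs_integral_mul_regenerative_sub_le hf hf0 hfb c (n t) (τ t) ht hB0
    (ae_of_all _ (hB t))

/-- Adding the constant `‖f‖` makes `f` nonnegative and changes both terms of the difference by the
same amount, since `cycleAverage` has mass one. -/
theorem tendsto_integral_mul_regenerative_sub (hC : IsCycleSequence P C) (f : E i →ᵇ ℝ) {B : ℝ}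
    (n : ℝ → ℕ) (τ : ℝ → ℝ) (hτ : ∀ᵐ ω ∂P, Tendsto (fun t => τ t - epoch C i (n t) ω) atTop atTop)
    {Φ : ℝ → Ω → ℝ} (hΦ : ∀ᶠ t in atTop, AEStronglyMeasurable[past C (n t)] (Φ t) P)
    (hB : ∀ t ω, |Φ t ω| ≤ B) :
    Tendsto (fun t => ∫ ω, Φ t ω * f (regenerative C i (τ t) ω) ∂P
      - (∫ x, f x ∂(cycleAverage P C i)) * ∫ ω, Φ t ω ∂P) atTop (𝓝 0) := by
  have := hC.isProbabilityMeasure_cycleAverage i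
  have hfb : ∀ x, |f x| ≤ ‖f‖ := fun x => f.norm_coe_le_norm x
  have h := hC.tendsto_integral_mul_regenerative_sub_of_nonneg (f := fun x => f x + ‖f‖)
    (f.continuous.add continuous_const) (b := 2 * ‖f‖) (fun x => by linarith [(abs_le.1 (hfb x)).1])
    (fun x => by linarith [(abs_le.1 (hfb x)).2]) n τ hτ hΦ hB
  refine h.congr' ?_
  filter_upwards [hΦ] with t ht
  have ht' : AEStronglyMeasurable (Φ t) P := ht.mono (past_le hC.measurable _)
  have hΦi : Integrable (Φ t) P := Integrable.of_bound ht' B (ae_of_all _ (hB t))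
  have hfi : Integrable (fun ω => f (regenerative C i (τ t) ω)) P :=
    Integrable.of_bound (hC.aestronglyMeasurable_comp_regenerative f.continuous _) ‖f‖
      (ae_of_all _ fun ω => hfb _)
  have hfi' : Integrable (fun x => f x) (cycleAverage P C i) := f.integrable _
  simp_rw [mul_add]
  rw [integral_add (hfi.bdd_mul ht' (ae_of_all _ (hB t))) (hΦi.mul_const _),
    integral_add hfi' (integrable_const _), integral_mul_const]
  simp
  ring

end IsCycleSequence

end Components

/-! ### Asymptotic independence on products -/

section Product

variable {Ω : Type*} {m : ℕ} {E : Fin m → Type*} [MeasurableSpace Ω] [∀ i, MetricSpace (E i)]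
  [∀ i, MeasurableSpace (E i)] [∀ i, BorelSpace (E i)] {P : Measure Ω} [IsProbabilityMeasure P]
  {C : ℕ → Ω → CycleSpace E}

namespace IsCycleSequence

/-- The sigma-algebra of the past is not completed, so a version measurable for it has to be
exhibited: the upper limit of the values at rounded times, which agrees wherever the path is right
continuous. -/
theorem exists_measurable_past_eq_cycleValue (hC : IsCycleSequence P C) {i : Fin m}
    {g : E i → ℝ≥0∞} (hg : Continuous g) (t : ℝ) {k n : ℕ} (hk : k < n) :
    ∃ H : Ω → ℝ≥0∞, Measurable[past C n] H ∧
      ∀ᵐ ω ∂P, H ω = cycleValue i g (t - epoch C i k ω) (C k ω) := by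
  have ha : Measurable[past C n] fun ω => t - epoch C i k ω :=
    Measurable.const_sub (measurable_epoch_past i hk.le) t
  refine ⟨fun ω => limsup (fun j => cycleValue i g (rightApprox j (t - epoch C i k ω)) (C k ω))
    atTop, ?_, ?_⟩
  · exact Measurable.limsup fun j => @measurable_cycleValue_rightApprox m E _ Ω (past C n) i g
      hg.measurable _ _ (measurable_past hk) ha j
  · filter_upwards [hC.rightContinuous k i] with ω hω
    exact ((continuousWithinAt_cycleValue hg hω _).tendsto.comp (tendsto_rightApprox _)).limsup_eq

/-- Before the `n`-th epoch the process is measurable with respect to the first `n` cycles. -/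
theorem exists_stronglyMeasurable_past_eq (hC : IsCycleSequence P C) {i : Fin m} (f : E i →ᵇ ℝ)
    {t : ℝ} (ht : 0 ≤ t) (n : ℕ) : ∃ F : Ω → ℝ, StronglyMeasurable[past C n] F ∧
      ∀ᵐ ω ∂P, t < epoch C i n ω → F ω = f (regenerative C i t ω) := by
  set g : E i → ℝ≥0∞ := fun x => ENNReal.ofReal (f x + ‖f‖) with hg
  have hgc : Continuous g := ENNReal.continuous_ofReal.comp (f.continuous.add continuous_const)
  have hH : ∀ k : ℕ, ∃ H : Ω → ℝ≥0∞, k < n → (Measurable[past C n] H ∧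
      ∀ᵐ ω ∂P, H ω = cycleValue i g (t - epoch C i k ω) (C k ω)) := fun k => by
    by_cases hk : k < n
    · obtain ⟨H, h⟩ := hC.exists_measurable_past_eq_cycleValue hgc t hk
      exact ⟨H, fun _ => h⟩
    · exact ⟨0, fun h => absurd h hk⟩
  choose H hH using hH
  have hsum : Measurable[past C n] fun ω => ∑ k ∈ Finset.range n, H k ω :=
    @Finset.measurable_sum _ _ _ _ _ _ (past C n) _ _ fun k hk => (hH k (Finset.mem_range.1 hk)).1
  refine ⟨fun ω => (∑ k ∈ Finset.range n, H k ω).toReal - ‖f‖,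
    (hsum.ennreal_toReal.sub_const _).stronglyMeasurable, ?_⟩
  have hae : ∀ᵐ ω ∂P, ∀ k, k < n → H k ω = cycleValue i g (t - epoch C i k ω) (C k ω) :=
    ae_all_iff.2 fun k => by
      by_cases hk : k < n
      · filter_upwards [(hH k hk).2] with ω hω _ using hω
      · exact ae_of_all _ fun ω h => absurd h hk
  filter_upwards [hae, hC.ae_nonneg i, hC.ae_tendsto_epoch i] with ω h1 h2 h3 h4
  rw [Finset.sum_congr rfl fun k hk => h1 k (Finset.mem_range.1 hk),
    sum_cycleValue h2 h3 g ht h4, hg, ENNReal.toReal_ofReal, add_sub_cancel_right]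
  linarith [(abs_le.1 (f.norm_coe_le_norm (regenerative C i t ω))).1]

theorem aestronglyMeasurable_past_prod (hC : IsCycleSequence P C) (f : ∀ i, E i →ᵇ ℝ)
    (s : Finset (Fin m)) {τ : Fin m → ℝ} (hτ : ∀ i ∈ s, 0 ≤ τ i) (n : ℕ) :
    AEStronglyMeasurable[past C n] (fun ω => ∏ i ∈ s, {ω | τ i < epoch C i n ω}.indicator
      (fun ω => f i (regenerative C i (τ i) ω)) ω) P := by
  have hF : ∀ i : Fin m, ∃ F : Ω → ℝ, i ∈ s → (StronglyMeasurable[past C n] F ∧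
      ∀ᵐ ω ∂P, τ i < epoch C i n ω → F ω = f i (regenerative C i (τ i) ω)) := fun i => by
    by_cases hi : i ∈ s
    · obtain ⟨F, h⟩ := hC.exists_stronglyMeasurable_past_eq (f i) (hτ i hi) n
      exact ⟨F, fun _ => h⟩
    · exact ⟨0, fun h => absurd h hi⟩
  choose F hF using hF
  refine ⟨fun ω => ∏ i ∈ s, {ω | τ i < epoch C i n ω}.indicator (F i) ω, ?_, ?_⟩
  · refine Finset.stronglyMeasurable_fun_prod s fun i hi => (hF i hi).1.indicator ?_
    exact measurable_epoch_past i le_rfl measurableSet_Ioi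
  · have hae : ∀ᵐ ω ∂P, ∀ i, i ∈ s → τ i < epoch C i n ω →
        F i ω = f i (regenerative C i (τ i) ω) :=
      ae_all_iff.2 fun i => by
        by_cases hi : i ∈ s
        · filter_upwards [(hF i hi).2] with ω hω _ using hω
        · exact ae_of_all _ fun ω h => absurd h hi
    filter_upwards [hae] with ω hω
    refine Finset.prod_congr rfl fun i hi => ?_
    by_cases h : τ i < epoch C i n ω
    · simp [h, hω i hi h]
    · simp [h]

theorem abs_prod_le (f : ∀ i, E i →ᵇ ℝ) (s : Finset (Fin m)) {y : Fin m → ℝ}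
    (hy : ∀ i ∈ s, |y i| ≤ ‖f i‖) : |∏ i ∈ s, y i| ≤ ∏ i ∈ s, ‖f i‖ := by
  rw [Finset.abs_prod]
  exact Finset.prod_le_prod (fun _ _ => abs_nonneg _) hy

/-- Asymptotic independence, tested on products of bounded continuous functions. -/
theorem tendsto_integral_prod (hC : IsCycleSequence P C)
    (hμ : ∀ i j, i ≠ j → meanCycle P C i ≠ meanCycle P C j) (f : ∀ i, E i →ᵇ ℝ) (β : Fin m → ℝ)
    (s : Finset (Fin m)) :
    Tendsto (fun t : ℝ => ∫ ω, ∏ i ∈ s, f i (regenerative C i (t + β i) ω) ∂P) atTop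
      (𝓝 (∏ i ∈ s, ∫ x, f i x ∂(cycleAverage P C i))) := by
  -- The component `a` added at each step has the smallest mean so far, hence runs through its
  -- cycles fastest.
  induction s using Finset.induction_on_min_value (meanCycle P C) with
  | empty => simp
  | insert a s has hle ih =>
    obtain ⟨l, hls, hla⟩ : ∃ l, (∀ x ∈ s, l < meanCycle P C x) ∧ meanCycle P C a < l := by
      have h1 : ∀ᶠ l in 𝓝[>] meanCycle P C a, ∀ x ∈ s, l < meanCycle P C x :=
        (Finset.eventually_all s).2 fun x hx => nhdsWithin_le_nhds (Iio_mem_nhds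
          (lt_of_le_of_ne (hle x hx) (hμ a x (fun h => has (h ▸ hx)))))
      exact (h1.and self_mem_nhdsWithin).exists
    have hl : 0 < l := (hC.mean_pos a).trans hla
    set n : ℝ → ℕ := fun t => ⌊t / l⌋₊ with hn
    set Ψ : ℝ → Ω → ℝ := fun t ω => ∏ i ∈ s, f i (regenerative C i (t + β i) ω) with hΨ
    -- The cutoff makes the product a function of the first `n t` cycles, up to null sets; almost
    -- surely it is eventually inactive.
    set Φ : ℝ → Ω → ℝ := fun t ω => ∏ i ∈ s, {ω | t + β i < epoch C i (n t) ω}.indicator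
      (fun ω => f i (regenerative C i (t + β i) ω)) ω with hΦ
    set B := ∏ i ∈ s, ‖f i‖ with hB
    have hΨB : ∀ t ω, |Ψ t ω| ≤ B := fun t ω => abs_prod_le f s fun i _ => (f i).norm_coe_le_norm _
    have hΦB : ∀ t ω, |Φ t ω| ≤ B := fun t ω => abs_prod_le f s fun i _ =>
      (norm_indicator_le_norm_self (fun ω => f i (regenerative C i (t + β i) ω)) ω).trans
        ((f i).norm_coe_le_norm _)
    have hm : ∀ i t, AEStronglyMeasurable (fun ω => f i (regenerative C i t ω)) P := fun i t =>
      hC.aestronglyMeasurable_comp_regenerative (f i).continuous t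
    have hΨm : ∀ t, AEStronglyMeasurable (Ψ t) P := fun t =>
      Finset.aestronglyMeasurable_fun_prod s fun i _ => hm i _
    have hΦm : ∀ t, AEStronglyMeasurable (Φ t) P := fun t =>
      Finset.aestronglyMeasurable_fun_prod s fun i _ =>
        (hm i _).indicator (hC.measurable_epoch i (n t) measurableSet_Ioi)
    have hΦpast : ∀ᶠ t in atTop, AEStronglyMeasurable[past C (n t)] (Φ t) P := by
      have h1 : ∀ᶠ t : ℝ in atTop, ∀ i ∈ s, 0 ≤ t + β i := (Finset.eventually_all s).2 fun i _ =>
        (eventually_ge_atTop (-β i)).mono fun t ht => by linarith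
      filter_upwards [h1] with t ht
      exact hC.aestronglyMeasurable_past_prod f s ht (n t)
    have hev : ∀ᵐ ω ∂P, ∀ᶠ t in atTop, Φ t ω = Ψ t ω := by
      have h1 : ∀ᵐ ω ∂P, ∀ i, Tendsto (fun n : ℕ => epoch C i n ω / n) atTop
          (𝓝 (meanCycle P C i)) := ae_all_iff.2 hC.ae_tendsto_epoch_div
      filter_upwards [h1] with ω hω
      have h2 : ∀ᶠ t : ℝ in atTop, ∀ i ∈ s, t + β i < epoch C i (n t) ω :=
        (Finset.eventually_all s).2 fun i hi => eventually_lt_comp_floor hl (hls i hi) (β i) (hω i)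
      filter_upwards [h2] with t ht
      exact Finset.prod_congr rfl fun i hi => by simp [ht i hi]
    have hdiff : ∀ Y : ℝ → Ω → ℝ, (∀ t, AEStronglyMeasurable (Y t) P) → ∀ b, (∀ t ω, |Y t ω| ≤ b) →
        Tendsto (fun t => ∫ ω, (Ψ t ω * Y t ω - Φ t ω * Y t ω) ∂P) atTop (𝓝 0) := by
      intro Y hYm b hY
      rw [← integral_zero Ω ℝ (μ := P)]
      refine tendsto_integral_filter_of_dominated_convergence (fun _ => B * b + B * b)
        (Eventually.of_forall fun t => ((hΨm t).mul (hYm t)).sub ((hΦm t).mul (hYm t)))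
        (Eventually.of_forall fun t => ae_of_all _ fun ω => ?_) (integrable_const _) ?_
      · have hB0 : 0 ≤ B := (abs_nonneg _).trans (hΨB t ω)
        refine (norm_sub_le _ _).trans (add_le_add ?_ ?_)
        · rw [norm_mul]; exact mul_le_mul (hΨB t ω) (hY t ω) (norm_nonneg _) hB0
        · rw [norm_mul]; exact mul_le_mul (hΦB t ω) (hY t ω) (norm_nonneg _) hB0
      · filter_upwards [hev] with ω hω
        refine tendsto_const_nhds.congr' ?_
        filter_upwards [hω] with t ht
        rw [ht, sub_self]
    have hint : ∀ {Z Y : Ω → ℝ} {b : ℝ}, AEStronglyMeasurable Z P → (∀ ω, |Z ω| ≤ B) →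
        AEStronglyMeasurable Y P → (∀ ω, |Y ω| ≤ b) → Integrable (fun ω => Z ω * Y ω) P :=
      fun hZ hZB hY hYb => (Integrable.of_bound hY _ (ae_of_all _ hYb)).bdd_mul hZ (ae_of_all _ hZB)
    have h1 := hC.tendsto_integral_mul_regenerative_sub (i := a) (f a) n (fun t => t + β a) (by
      filter_upwards [hC.ae_tendsto_epoch_div a] with ω hω
      exact tendsto_sub_comp_floor_atTop hl hla (β a) hω) hΦpast hΦB
    have h2 := hdiff (fun t ω => f a (regenerative C a (t + β a) ω)) (fun t => hm a _) ‖f a‖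
      fun t ω => (f a).norm_coe_le_norm _
    have h3 := (hdiff (fun _ _ => 1) (fun _ => aestronglyMeasurable_const) 1 (by simp))
    -- With `Y` the factor of `a` and `c` its limiting mean, the terms are `E ΦY - c E Φ`, `E ΨY - E
    -- ΦY`, `-c (E Ψ - E Φ)` and `c E Ψ`. They add up to `E ΨY`.
    have h4 := ((h1.add h2).sub (h3.const_mul (∫ x, f a x ∂(cycleAverage P C a)))).add
      (ih.const_mul (∫ x, f a x ∂(cycleAverage P C a)))
    rw [Finset.prod_insert has]
    simp only [mul_zero, add_zero, sub_zero, zero_add] at h4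
    refine h4.congr fun t => ?_
    simp_rw [Finset.prod_insert has]
    rw [integral_sub (hint (hΨm t) (hΨB t) (hm a _) fun ω => (f a).norm_coe_le_norm _)
      (hint (hΦm t) (hΦB t) (hm a _) fun ω => (f a).norm_coe_le_norm _),
      integral_sub (hint (hΨm t) (hΨB t) aestronglyMeasurable_const (b := 1) (by simp))
      (hint (hΦm t) (hΦB t) aestronglyMeasurable_const (b := 1) (by simp))]
    simp only [mul_one, mul_comm (f a _)]
    ring

end IsCycleSequence

end Product

/-! ### Weak convergence to a product law -/

section WeakConvergence

section Approximation

variable {X : Type*} [MetricSpace X] [MeasurableSpace X] [BorelSpace X]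

/-- The indicator of a closed set is the limit of a sequence of larger continuous functions. -/
theorem exists_boundedContinuous_seq_of_isClosed (ν : Measure X) [IsFiniteMeasure ν] {F : Set X}
    (hF : IsClosed F) : ∃ f : ℕ → X →ᵇ ℝ, (∀ n x, F.indicator 1 x ≤ f n x) ∧
      (∀ n x, f n x ≤ 1) ∧ Tendsto (fun n => ∫ x, f n x ∂ν) atTop (𝓝 (ν.real F)) := by
  have h1 : ∀ n x, ‖(hF.apprSeq n x : ℝ)‖ ≤ 1 := fun n x => by
    simpa using HasOuterApproxClosed.apprSeq_apply_le_one hF n x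
  refine ⟨fun n => BoundedContinuousFunction.ofNormedAddCommGroup
    (fun x => (hF.apprSeq n x : ℝ)) (by fun_prop) 1 (h1 n), fun n x => ?_, fun n x => ?_, ?_⟩
  · by_cases hx : x ∈ F
    · simp [hx, HasOuterApproxClosed.apprSeq_apply_eq_one hF n hx]
    · simp [hx]
  · exact (le_abs_self _).trans (h1 n x)
  · have h2 : ν.real F = ∫ x, F.indicator 1 x ∂ν := (integral_indicator_one hF.measurableSet).symm
    rw [h2]
    refine tendsto_integral_of_dominated_convergence (fun _ => 1)
      (fun n => (BoundedContinuousFunction.continuous _).aestronglyMeasurable) (integrable_const _)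
      (fun n => ae_of_all _ (h1 n)) (ae_of_all _ fun x => ?_)
    have h3 := (NNReal.continuous_coe.tendsto _).comp
      (tendsto_pi_nhds.1 (HasOuterApproxClosed.tendsto_apprSeq hF) x)
    have h4 : ((F.indicator (fun _ => (1 : ℝ≥0)) x : ℝ≥0) : ℝ) = F.indicator 1 x := by
      classical
      simp only [Set.indicator_apply]
      split_ifs <;> simp
    rwa [h4] at h3

/-- The indicator of an open set is the limit of a sequence of smaller continuous functions. -/
theorem exists_boundedContinuous_seq_of_isOpen (ν : Measure X) [IsProbabilityMeasure ν] {U : Set X}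
    (hU : IsOpen U) : ∃ f : ℕ → X →ᵇ ℝ, (∀ n x, 0 ≤ f n x) ∧
      (∀ n x, f n x ≤ U.indicator 1 x) ∧ Tendsto (fun n => ∫ x, f n x ∂ν) atTop (𝓝 (ν.real U)) := by
  obtain ⟨f, hf, hf1, hlim⟩ := exists_boundedContinuous_seq_of_isClosed ν hU.isClosed_compl
  refine ⟨fun n => 1 - f n, fun n x => by simpa using hf1 n x, fun n x => ?_, ?_⟩
  · have := hf n x
    by_cases hx : x ∈ U <;> simp [hx] at this ⊢ <;> linarith
  · have h := hlim.const_sub 1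
    rw [probReal_compl_eq_one_sub hU.measurableSet, sub_sub_cancel] at h
    refine h.congr fun n => ?_
    simp [integral_sub (integrable_const (1 : ℝ)) ((f n).integrable ν)]

end Approximation

variable {ι κ : Type*} [Fintype ι] {X : ι → Type*} [∀ i, MetricSpace (X i)]
  [∀ i, MeasurableSpace (X i)] [∀ i, BorelSpace (X i)] {l : Filter κ}
  {μ : κ → ProbabilityMeasure (∀ i, X i)} {ν : ∀ i, ProbabilityMeasure (X i)}

theorem integrable_prod_boundedContinuous (ρ : Measure (∀ i, X i)) [IsFiniteMeasure ρ]
    (f : ∀ i, X i →ᵇ ℝ) : Integrable (fun x => ∏ i, f i (x i)) ρ := by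
  refine Integrable.of_bound (C := ∏ i, ‖f i‖) (Finset.aestronglyMeasurable_fun_prod _ fun i _ =>
    ((f i).continuous.measurable.comp (measurable_pi_apply i)).aestronglyMeasurable)
    (ae_of_all _ fun x => ?_)
  rw [norm_prod]
  exact Finset.prod_le_prod (fun _ _ => norm_nonneg _) fun i _ => (f i).norm_coe_le_norm _

theorem prod_indicator_one (s : ∀ i, Set (X i)) (x : ∀ i, X i) :
    ∏ i, (s i).indicator (1 : X i → ℝ) (x i) = (Set.univ.pi s).indicator 1 x := by
  classical
  by_cases hx : x ∈ Set.univ.pi s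
  · rw [Set.indicator_of_mem hx]
    exact Finset.prod_eq_one fun i _ => by simp [hx i (Set.mem_univ i)]
  · rw [Set.indicator_of_notMem hx]
    simp only [Set.mem_univ_pi, not_forall] at hx
    obtain ⟨i, hi⟩ := hx
    exact Finset.prod_eq_zero (Finset.mem_univ i) (by simp [hi])

/-- Convergence on rectangles whose sides have null frontiers. -/
theorem tendsto_measureReal_pi_of_tendsto_integral_prod
    (h : ∀ f : ∀ i, X i →ᵇ ℝ, Tendsto (fun k => ∫ x, ∏ i, f i (x i) ∂(μ k : Measure (∀ i, X i))) l
      (𝓝 (∏ i, ∫ x, f i x ∂(ν i : Measure (X i))))) {s : ∀ i, Set (X i)}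
    (hsm : ∀ i, MeasurableSet (s i)) (hs : ∀ i, (ν i : Measure (X i)) (frontier (s i)) = 0) :
    Tendsto (fun k => (μ k : Measure (∀ i, X i)).real (Set.univ.pi s)) l
      (𝓝 (∏ i, (ν i : Measure (X i)).real (s i))) := by
  -- Each side is squeezed between continuous functions below the indicator of its interior and
  -- above that of its closure; a null frontier gives these the same limiting mass.
  choose u hu hu1 hulim using fun i =>
    exists_boundedContinuous_seq_of_isClosed (ν i : Measure (X i)) (isClosed_closure (s := s i))
  choose v hv0 hv hvlim using fun i =>
    exists_boundedContinuous_seq_of_isOpen (ν i : Measure (X i)) (isOpen_interior (s := s i))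
  have hcl : ∀ i, (ν i : Measure (X i)).real (closure (s i)) = (ν i : Measure (X i)).real (s i) :=
    fun i => measureReal_congr (closure_ae_eq_of_null_frontier (hs i))
  have hint : ∀ i, (ν i : Measure (X i)).real (interior (s i)) =
      (ν i : Measure (X i)).real (s i) :=
    fun i => measureReal_congr (interior_ae_eq_of_null_frontier (hs i))
  have hind : ∀ k, (μ k : Measure (∀ i, X i)).real (Set.univ.pi s) =
      ∫ x, ∏ i, (s i).indicator (1 : X i → ℝ) (x i) ∂(μ k : Measure (∀ i, X i)) := fun k => by
    simp_rw [prod_indicator_one]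
    exact (integral_indicator_one (MeasurableSet.univ_pi hsm)).symm
  have hsi : ∀ k, Integrable (fun x => ∏ i, (s i).indicator (1 : X i → ℝ) (x i))
      (μ k : Measure (∀ i, X i)) := fun k => by
    simp_rw [prod_indicator_one]
    exact (integrable_const (1 : ℝ)).indicator (MeasurableSet.univ_pi hsm)
  have h0 : ∀ i x, 0 ≤ (s i).indicator (1 : X i → ℝ) x := fun i x =>
    Set.indicator_nonneg (fun _ _ => zero_le_one) x
  have hup : ∀ n k, (μ k : Measure (∀ i, X i)).real (Set.univ.pi s) ≤
      ∫ x, ∏ i, u i n (x i) ∂(μ k : Measure (∀ i, X i)) := fun n k => by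
    rw [hind]
    refine integral_mono (hsi k) (integrable_prod_boundedContinuous _ _) fun x => ?_
    exact Finset.prod_le_prod (fun i _ => h0 i _) fun i _ =>
      (Set.indicator_le_indicator_of_subset subset_closure (fun _ => zero_le_one) _).trans (hu i n _)
  have hlo : ∀ n k, ∫ x, ∏ i, v i n (x i) ∂(μ k : Measure (∀ i, X i)) ≤
      (μ k : Measure (∀ i, X i)).real (Set.univ.pi s) := fun n k => by
    rw [hind]
    refine integral_mono (integrable_prod_boundedContinuous _ _) (hsi k) fun x => ?_
    exact Finset.prod_le_prod (fun i _ => hv0 i n _) fun i _ => (hv i n _).trans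
      (Set.indicator_le_indicator_of_subset interior_subset (fun _ => zero_le_one) _)
  have hU := tendsto_finsetProd Finset.univ fun i _ => hulim i
  have hV := tendsto_finsetProd Finset.univ fun i _ => hvlim i
  simp_rw [hcl] at hU
  simp_rw [hint] at hV
  refine tendsto_order.2 ⟨fun a ha => ?_, fun a ha => ?_⟩
  · obtain ⟨n, hn⟩ := ((tendsto_order.1 hV).1 a ha).exists
    filter_upwards [(tendsto_order.1 (h fun i => v i n)).1 a hn] with k hk
    exact hk.trans_le (hlo n k)
  · obtain ⟨n, hn⟩ := ((tendsto_order.1 hU).2 a ha).exists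
    filter_upwards [(tendsto_order.1 (h fun i => u i n)).2 a hn] with k hk
    exact (hup n k).trans_lt hk

/-- Products of bounded continuous functions determine weak convergence to a product law. -/
theorem tendsto_probabilityMeasure_pi [∀ i, SecondCountableTopology (X i)]
    [l.IsCountablyGenerated]
    (h : ∀ f : ∀ i, X i →ᵇ ℝ, Tendsto (fun k => ∫ x, ∏ i, f i (x i) ∂(μ k : Measure (∀ i, X i))) l
      (𝓝 (∏ i, ∫ x, f i x ∂(ν i : Measure (X i))))) :
    Tendsto μ l (𝓝 (ProbabilityMeasure.pi ν)) := by
  let S : Set (Set (∀ i, X i)) := {t | ∃ s : ∀ i, Set (X i), t = Set.univ.pi s ∧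
    (∀ i, MeasurableSet (s i)) ∧ ∀ i, (ν i : Measure (X i)) (frontier (s i)) = 0}
  have hS : IsPiSystem S := by
    rintro - ⟨s, rfl, hsm, hs⟩ - ⟨s', rfl, hsm', hs'⟩ -
    exact ⟨fun i => s i ∩ s' i, Set.pi_inter_distrib.symm, fun i => (hsm i).inter (hsm' i),
      fun i => null_frontier_inter (hs i) (hs' i)⟩
  refine hS.tendsto_probabilityMeasure_of_tendsto_of_mem ?_ (fun U hU x hx => ?_) ?_
  · rintro - ⟨s, rfl, hsm, -⟩
    exact MeasurableSet.univ_pi hsm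
  · obtain ⟨ε, hε, hεU⟩ := Metric.isOpen_iff.1 hU x hx
    have h1 : ∀ i, ∃ r ∈ Set.Ioo 0 ε,
        -- The radius may vary with the coordinate: the product of the balls still lies in the
        -- `ε`-ball of the sup metric.
        (ν i : Measure (X i)) (frontier (Metric.thickening r {x i})) = 0 := fun i =>
      exists_null_frontier_thickening _ _ hε
    choose r hr hr0 using h1
    refine ⟨Set.univ.pi fun i => Metric.ball (x i) (r i), ⟨_, rfl, fun i => measurableSet_ball,
      fun i => by simpa using hr0 i⟩, ?_, ?_⟩
    · exact (isOpen_set_pi Set.finite_univ fun _ _ => Metric.isOpen_ball).mem_nhds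
        fun i _ => Metric.mem_ball_self (hr i).1
    · refine Set.Subset.trans ?_ hεU
      rw [ball_pi _ hε]
      exact Set.pi_mono fun i _ => Metric.ball_subset_ball (hr i).2.le
  · rintro - ⟨s, rfl, hsm, hs⟩
    have h1 := tendsto_measureReal_pi_of_tendsto_integral_prod h hsm hs
    rw [← NNReal.tendsto_coe]
    simpa [ProbabilityMeasure.pi_pi] using h1

end WeakConvergence

theorem corollary2 {Ω : Type*} [MeasurableSpace Ω] (P : Measure Ω) [IsProbabilityMeasure P]
    (m : ℕ) (hm : 2 ≤ m) {E : Fin m → Type*} [∀ i, MetricSpace (E i)]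
    [∀ i, MeasurableSpace (E i)] [∀ i, BorelSpace (E i)]
    (C : ℕ → Ω → ∀ i, (ℝ≥0 → E i) × ℝ) (hC : IsCycleSequence P C)
    (hμ : ∀ i j, i ≠ j → meanCycle P C i ≠ meanCycle P C j) :
    ∃ ν : ∀ i, ProbabilityMeasure (E i),
      (∀ i, IsCycleAverage P C i (ν i : Measure (E i))) ∧
      ∀ β : Fin m → ℝ,
        AsymptoticallyIndependent P (fun i t => regenerative C i (t + β i)) ν := by
  let ν : ∀ i, ProbabilityMeasure (E i) := fun i =>
    ⟨cycleAverage P C i, hC.isProbabilityMeasure_cycleAverage i⟩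
  refine ⟨ν, fun i => hC.isCycleAverage i, fun β => ?_⟩
  have hmeas : ∀ i t, AEMeasurable (regenerative C i (t + β i)) P := fun i t =>
    hC.aemeasurable_regenerative i _
  have hprod : ∀ f : ∀ i, E i →ᵇ ℝ,
      Tendsto (fun t : ℝ => ∫ ω, ∏ i, f i (regenerative C i (t + β i) ω) ∂P) atTop
        (𝓝 (∏ i, ∫ x, f i x ∂(ν i : Measure (E i)))) := fun f =>
    hC.tendsto_integral_prod hμ f β Finset.univ
  refine ⟨hmeas, hprod, ?_⟩
  intro _
  have hmv : ∀ t, AEMeasurable (fun ω i => regenerative C i (t + β i) ω) P := fun t =>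
    aemeasurable_pi_lambda _ fun i => hmeas i t
  refine ⟨hmv, measurable_id.aemeasurable, ?_⟩
  have h := tendsto_probabilityMeasure_pi (l := (atTop : Filter ℝ)) (ν := ν)
    (μ := fun t => ⟨P.map fun ω i => regenerative C i (t + β i) ω,
      Measure.isProbabilityMeasure_map (hmv t)⟩) fun f => by
    refine (hprod f).congr fun t => ?_
    exact (integral_map (f := fun x : ∀ i, E i => ∏ i, f i (x i)) (hmv t)
      (have := Measure.isProbabilityMeasure_map (hmv t)
       (integrable_prod_boundedContinuous _ f).aestronglyMeasurable)).symm
  have hid : (⟨(Measure.pi fun i => (ν i : Measure (E i))).map fun x => x,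
      Measure.isProbabilityMeasure_map measurable_id.aemeasurable⟩ : ProbabilityMeasure (∀ i, E i)) =
      ProbabilityMeasure.pi ν := Subtype.ext Measure.map_id
  rw [hid]
  exact h
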